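/- Let $\mathcal K=\mathcal K^1\times\cdots\times\mathcal K^k\subset\mathbb R^n$, $k\ge1$, be a product of second-order cones $\mathcal K^i=\{u=(u_1,u_2)\in\mathbb R\times\mathbb R^{n_i-1}: u_1\ge\|u_2\|\}$, $n_i\ge 1$ (for $n_i=1$ the half line; linear cones are products of these), let $A\in\mathbb R^{p\times n}$ have rank $p$, and let $b\in\mathbb R^p$, $c\in\mathbb R^n$. Let $e$ have blocks $e^{(i)}=(1,0)$, and let $\mathrm{mat}(v)$ and $T_v$ be the block diagonal matrices with blocks, for $u=v^{(i)}$, $$\begin{pmatrix}u_1&u_2^T\\u_2&u_1I\end{pmatrix}\quad\text{and}\quad \begin{pmatrix}u_1&u_2^T\\u_2&\beta_uI+\frac{u_2u_2^T}{\beta_u+u_1}\end{pmatrix},\qquad \beta_u=\sqrt{u_1^2-\|u_2\|^2}.$$ For $z=(x,y,s,\kappa,\tau)\in\mathbb R^n\times\mathbb R^p\times\mathbb R^n\times\mathbb R\times\mathbb R$ put $\mu(z)=(x^Ts+\kappa\tau)/(k+1)$, $r_p(z)=Ax-\tau b$, $r_d(z)=A^Ty+s-\tau c$, $r_g(z)=b^Ty-c^Tx-\kappa$.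 For $\gamma\in(0,1)$ let $\mathcal N_2(\gamma)$ be the set of all $z$ with $x,s\in\mathrm{int}\,\mathcal K$, $\kappa,\tau>0$ and $\sqrt2\,\|(T_xs,\kappa\tau)-\mu(z)(e,1)\|\le\gamma\mu(z)$. Let $\mathcal G$ be the set of the matrices $D=\mathrm{blkdiag}(\theta_1G_1,\dots,\theta_kG_k)$ with $\theta_i>0$ and $G_i^TQ_iG_i=Q_i$, where $Q_i=\mathrm{diag}(1,-I_{n_i-1})$. Let $\delta\in(0,1)$ and $\nu=1-\delta/\sqrt{2(k+1)}$. The infeasible interior point method with input $z_0\in\mathcal N_2(\gamma)$ and $\epsilon\in(0,1)$ stops at an iterate $z$ when $\|r_p(z)\|\le\epsilon\|r_p(z_0)\|$, $\|r_d(z)\|\le\epsilon\|r_d(z_0)\|$ and $\mu(z)\le\epsilon\mu(z_0)$. Otherwise it takes some $D\in\mathcal G$ (which may change from one iteration to the next), puts $\bar x=D^{-T}x$, $\bar s=Ds$, $\mu=\mu(z)$, and replaces $z$ by $z+\Delta z$, where $\Delta z=(\Delta x,\Delta y,\Delta s,\Delta\kappa,\Delta\tau)$ solves $$A\Delta x-b\Delta\tau=-(1-\nu)r_p(z),\qquad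 -A^T\Delta y+c\Delta\tau-\Delta s=(1-\nu)r_d(z),\qquad b^T\Delta y-c^T\Delta x-\Delta\kappa=-(1-\nu)r_g(z),$$ $$\mathrm{mat}(\bar x)D\Delta s+\mathrm{mat}(\bar s)D^{-T}\Delta x=\nu\mu e-\mathrm{mat}(\bar x)\,\mathrm{mat}(\bar s)e,\qquad \kappa\Delta\tau+\tau\Delta\kappa=\nu\mu-\kappa\tau.$$ Proposition 5. Let $\gamma\in(0,1/3)$ and $\delta\in(0,1)$. There is a constant $C>0$, depending on $\gamma$ and $\delta$ only, such that for all $k$ with $$\frac{4(\gamma^2+\delta^2)}{(1-3\gamma)^2}\Bigl(1-\frac{\delta}{\sqrt{2(k+1)}}\Bigr)^{-1}<\gamma,$$ for all data as above, all $z_0\in\mathcal N_2(\gamma)$, all $\epsilon\in(0,1)$ and all choices of the scaling matrices in $\mathcal G$: for every $j$ such that the method has performed $j$ iterations, the iterate $z_j$ reached satisfies $z_j\in\mathcal N_2(\gamma)$ and $$r_p(z_j)=\nu^jr_p(z_0),\quad r_d(z_j)=\nu^jr_d(z_0),\quad \mu(z_j)=\nu^j\mu(z_0)$$ (in particular $\|r_p(z_j)\|=\nu^j\|r_p(z_0)\|$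 and $\|r_d(z_j)\|=\nu^j\|r_d(z_0)\|$); the linear system at $z_j$ has exactly one solution for every $D\in\mathcal G$, so that the method is well defined; and the method stops after at most $\lceil C\sqrt k\,\log(1/\epsilon)\rceil$ iterations, that is, its iteration complexity is $O(\sqrt k\log(1/\epsilon))$. -/

import Mathlib

open scoped Matrix

noncomputable section

namespace SOCP

/-- The Euclidean norm of a finite real vector. -/
def eucNorm {ι : Type*} [Fintype ι] (v : ι → ℝ) : ℝ := ‖WithLp.toLp 2 v‖

/-- Coordinates of a vector that is split into `k` blocks, the `i`-th one of dimension
`nᵢ = d i + 1 ≥ 1`. A block with `d i = 0` is a one-dimensional linear cone. -/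
abbrev Idx {k : ℕ} (d : Fin k → ℕ) : Type := Σ i : Fin k, Fin (d i + 1)

/-- The space `ℝⁿ`, `n = ∑ nᵢ`. -/
abbrev Vec {k : ℕ} (d : Fin k → ℕ) : Type := Idx d → ℝ

/-- The matrix `[[a, vᵀ], [v, M]]`. -/
def bordered {m : ℕ} (a : ℝ) (v : Fin m → ℝ) (M : Matrix (Fin m) (Fin m) ℝ) :
    Matrix (Fin (m + 1)) (Fin (m + 1)) ℝ :=
  Matrix.of fun i j =>
    Fin.cases (motive := fun _ => ℝ)
      (Fin.cases (motive := fun _ => ℝ) a (fun j' => v j') j)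
      (fun i' => Fin.cases (motive := fun _ => ℝ) (v i') (fun j' => M i' j') j) i

/-- The arrow head matrix `[[u₁, u₂ᵀ], [u₂, u₁ I]]` of `u = (u₁, u₂)`. -/
def arrow {m : ℕ} (u : Fin (m + 1) → ℝ) : Matrix (Fin (m + 1)) (Fin (m + 1)) ℝ :=
  bordered (u 0) (Fin.tail u) (u 0 • (1 : Matrix (Fin m) (Fin m) ℝ))

/-- The matrix `diag(1, -I)`. -/
def lorentz (m : ℕ) : Matrix (Fin (m + 1)) (Fin (m + 1)) ℝ :=
  bordered 1 0 (-1)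

/-- `β_u = √(u₁² - ‖u₂‖²)`. -/
def beta {m : ℕ} (u : Fin (m + 1) → ℝ) : ℝ :=
  Real.sqrt (u 0 ^ 2 - eucNorm (Fin.tail u) ^ 2)

/-- The matrix `T_u = [[u₁, u₂ᵀ], [u₂, β_u I + u₂ u₂ᵀ / (β_u + u₁)]]`. -/
def tBlock {m : ℕ} (u : Fin (m + 1) → ℝ) : Matrix (Fin (m + 1)) (Fin (m + 1)) ℝ :=
  bordered (u 0) (Fin.tail u)
    (beta u • (1 : Matrix (Fin m) (Fin m) ℝ)
      + (1 / (beta u + u 0)) • Matrix.vecMulVec (Fin.tail u) (Fin.tail u))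

section Blocks

variable {k : ℕ} {d : Fin k → ℕ}

/-- The `i`-th block of a vector. -/
def block (v : Vec d) (i : Fin k) : Fin (d i + 1) → ℝ := fun j => v ⟨i, j⟩

/-- The product of the second-order cones `{u : ‖u₂‖ ≤ u₁}`. -/
def cone (d : Fin k → ℕ) : Set (Vec d) :=
  {v | ∀ i, eucNorm (Fin.tail (block v i)) ≤ block v i 0}

/-- The unit element `e` of the Jordan algebra. -/
def unit (d : Fin k → ℕ) : Vec d := fun a => if a.2 = 0 then 1 else 0

/-- The block diagonal arrow head matrix `mat(v)`. -/
def mat (v : Vec d) : Matrix (Idx d) (Idx d) ℝ :=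
  Matrix.blockDiagonal' fun i => arrow (block v i)

/-- The block diagonal matrix `T_v`. -/
def tMat (v : Vec d) : Matrix (Idx d) (Idx d) ℝ :=
  Matrix.blockDiagonal' fun i => tBlock (block v i)

/-- The set `𝒢` of scaling matrices `blkdiag(θᵢ Gᵢ)` with `θᵢ > 0` and `Gᵢᵀ Qᵢ Gᵢ = Qᵢ`. -/
def scalings (d : Fin k → ℕ) : Set (Matrix (Idx d) (Idx d) ℝ) :=
  {D | ∃ (θ : Fin k → ℝ) (G : ∀ i, Matrix (Fin (d i + 1)) (Fin (d i + 1)) ℝ),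
    (∀ i, 0 < θ i) ∧ (∀ i, (G i)ᵀ * lorentz (d i) * G i = lorentz (d i)) ∧
    D = Matrix.blockDiagonal' fun i => θ i • G i}

end Blocks

/-- A tuple `(x, y, s, κ, τ)` of variables of the homogeneous self-dual model. -/
@[ext]
structure Point {k : ℕ} (d : Fin k → ℕ) (p : ℕ) where
  x : Vec d
  y : Fin p → ℝ
  s : Vec d
  κ : ℝ
  τ : ℝ

/-- The componentwise sum of two tuples. -/
instance {k : ℕ} {d : Fin k → ℕ} {p : ℕ} : Add (Point d p) :=
  ⟨fun z w => ⟨z.x + w.x, z.y + w.y, z.s + w.s, z.κ + w.κ, z.τ + w.τ⟩⟩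

section Model

variable {k : ℕ} {d : Fin k → ℕ} {p : ℕ}

/-- The central path coefficient `μ = (xᵀ s + κ τ) / (k + 1)`. -/
def mu (z : Point d p) : ℝ := (z.x ⬝ᵥ z.s + z.κ * z.τ) / ((k : ℝ) + 1)

/-- The interior of `𝒞 = 𝒦 × ℝᵖ × 𝒦 × ℝ≥0 × ℝ≥0`. -/
def interiorC (d : Fin k → ℕ) (p : ℕ) : Set (Point d p) :=
  {z | z.x ∈ interior (cone d) ∧ z.s ∈ interior (cone d) ∧
    z.κ ∈ interior (Set.Ici (0 : ℝ)) ∧ z.τ ∈ interior (Set.Ici (0 : ℝ))}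

/-- `d₂ = √2 ‖(T_x s, κ τ) - μ (e, 1)‖`. -/
def dist2 (z : Point d p) : ℝ :=
  Real.sqrt 2 * eucNorm
    (Sum.elim (tMat z.x *ᵥ z.s - mu z • unit d) (fun _ : Unit => z.κ * z.τ - mu z))

/-- The central path neighborhood `𝒩₂(γ)`. -/
def nbhd2 (d : Fin k → ℕ) (p : ℕ) (γ : ℝ) : Set (Point d p) :=
  {z | z ∈ interiorC d p ∧ dist2 z ≤ γ * mu z}

/-- The primal residual `A x - τ b`. -/
def resP (A : Matrix (Fin p) (Idx d) ℝ) (b : Fin p → ℝ) (z : Point d p) : Fin p → ℝ :=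
  A *ᵥ z.x - z.τ • b

/-- The dual residual `Aᵀ y + s - τ c`. -/
def resD (A : Matrix (Fin p) (Idx d) ℝ) (c : Vec d) (z : Point d p) : Vec d :=
  Aᵀ *ᵥ z.y + z.s - z.τ • c

/-- `Δ = (Δx, Δy, Δs, Δκ, Δτ)` solves the linear system at `z` that is scaled by `D`, with
`x̄ = D⁻ᵀ x` and `s̄ = D s`. -/
def IsDirection (A : Matrix (Fin p) (Idx d) ℝ) (b : Fin p → ℝ) (c : Vec d)
    (ν : ℝ) (D : Matrix (Idx d) (Idx d) ℝ) (z Δ : Point d p) : Prop :=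
  A *ᵥ Δ.x - Δ.τ • b = -((1 - ν) • (A *ᵥ z.x - z.τ • b)) ∧
  -(Aᵀ *ᵥ Δ.y) + Δ.τ • c - Δ.s = -((1 - ν) • (-(Aᵀ *ᵥ z.y) + z.τ • c - z.s)) ∧
  b ⬝ᵥ Δ.y - c ⬝ᵥ Δ.x - Δ.κ = -((1 - ν) * (b ⬝ᵥ z.y - c ⬝ᵥ z.x - z.κ)) ∧
  mat ((D⁻¹)ᵀ *ᵥ z.x) *ᵥ (D *ᵥ Δ.s) + mat (D *ᵥ z.s) *ᵥ ((D⁻¹)ᵀ *ᵥ Δ.x) =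
    (ν * mu z) • unit d - mat ((D⁻¹)ᵀ *ᵥ z.x) *ᵥ (mat (D *ᵥ z.s) *ᵥ unit d) ∧
  z.κ * Δ.τ + z.τ * Δ.κ = ν * mu z - z.κ * z.τ

/-- The stop criteria at `z` for the starting point `z₀` and the threshold `ε`. -/
def Stop (A : Matrix (Fin p) (Idx d) ℝ) (b : Fin p → ℝ) (c : Vec d)
    (ε : ℝ) (z₀ z : Point d p) : Prop :=
  eucNorm (resP A b z) ≤ ε * eucNorm (resP A b z₀) ∧
  eucNorm (resD A c z) ≤ ε * eucNorm (resD A c z₀) ∧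
  mu z ≤ ε * mu z₀

/-- The factor `ν = 1 - δ / √(2 (k + 1))`. -/
def nuFactor (k : ℕ) (δ : ℝ) : ℝ := 1 - δ / Real.sqrt (2 * ((k : ℝ) + 1))

/-- `z 0, …, z j` are the first `j + 1` iterates of a run of the interior point method from `z₀`:
every loop iteration starts with the stop criteria not satisfied, picks some scaling matrix in `𝒢`
(which may depend on anything and change between iterations), solves the scaled linear system and
takes the full step. -/
def IsRun (A : Matrix (Fin p) (Idx d) ℝ) (b : Fin p → ℝ) (c : Vec d)
    (δ ε : ℝ) (z₀ : Point d p) (j : ℕ) (z : ℕ → Point d p) : Prop :=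
  z 0 = z₀ ∧ ∀ i < j, ¬ Stop A b c ε z₀ (z i) ∧
    ∃ D ∈ scalings d, ∃ Δ : Point d p,
      IsDirection A b c (nuFactor k δ) D (z i) Δ ∧ z (i + 1) = z i + Δ

end Model

end SOCP

end

open scoped Matrix

noncomputable section

namespace SOCP

/-! Everything is measured in the frame in which the primal iterate becomes the unit. With `w = T_x
s`, `u = T_x⁻¹ Δx`, `v = T_x Δs`, the neighborhood says that `w` is close to `μ e`, and inner
products of primal with dual vectors are unchanged.

The arbitrary scaling `D` is harmless because `B = D⁻ᵀ T_x` is, blockwise, a multiple of a Lorentz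
transformation. Pulling the scaled complementarity equation back by `Bᵀ`, only the first row of `B`
survives (`transpose_mulVec_arrow`). By `block_equation`, the result is `v + w ∘ u = ξ e` up to an
error `(n·ū) w̄ - (n·w̄) ū` in the tails, with `‖n‖ ≤ 1`; heads are exact. Since `w̄` is small, so
is the error, uniformly in `D`.

Hence `v + μ u` is a centering term plus perturbations of size at most `3γ ‖v + μ u‖`. The self-dual
structure makes the full directions orthogonal, so Pythagoras bounds both (`direction_estimate`).
The same estimate with zero right-hand side shows that the linear system is nonsingular.

After the full step, the distance `‖T_x s - t e‖` depends only on `x·s` and the Lorentz forms of `x`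
and `s`. It may therefore be computed in the frame, where it is dominated by the distance formed
with the Jordan product (`block_distance_le`). There `(e + u) ∘ (w + v) - νμ e` is the skew error
plus `u ∘ v`, both of second order, and the condition on `γ`, `δ`, `k` absorbs them. Residuals and
`μ` shrink exactly by `ν`, and `log ν ≤ ν - 1` gives the complexity. -/

theorem eucNorm_sq {ι : Type*} [Fintype ι] (v : ι → ℝ) : eucNorm v ^ 2 = v ⬝ᵥ v := by
  simp only [eucNorm, EuclideanSpace.norm_sq_eq, dotProduct, Real.norm_eq_abs, sq_abs]
  exact Finset.sum_congr rfl fun i _ => pow_two _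

theorem eucNorm_nonneg {ι : Type*} [Fintype ι] (v : ι → ℝ) : 0 ≤ eucNorm v := norm_nonneg _

theorem eucNorm_smul {ι : Type*} [Fintype ι] (r : ℝ) (v : ι → ℝ) (hr : 0 ≤ r) :
    eucNorm (r • v) = r * eucNorm v := by
  simp only [eucNorm, WithLp.toLp_smul, norm_smul, Real.norm_eq_abs, abs_of_nonneg hr]

theorem dotProduct_self_nonneg' {ι : Type*} [Fintype ι] (v : ι → ℝ) : 0 ≤ v ⬝ᵥ v := by
  rw [← eucNorm_sq]; positivity

theorem dotProduct_sq_le {ι : Type*} [Fintype ι] (v w : ι → ℝ) :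
    (v ⬝ᵥ w) ^ 2 ≤ (v ⬝ᵥ v) * (w ⬝ᵥ w) := by
  have h := Finset.sum_mul_sq_le_sq_mul_sq Finset.univ v w
  simpa only [dotProduct, ← pow_two] using h

/-! ### Algebra of one second-order cone: arrow matrices, `T_u` and the Lorentz form. -/

section Block

variable {m : ℕ}

theorem dot_eq (p q : Fin (m + 1) → ℝ) :
    p ⬝ᵥ q = p 0 * q 0 + Fin.tail p ⬝ᵥ Fin.tail q := by
  simp only [dotProduct, Fin.sum_univ_succ, Fin.tail]

theorem ext_tail {p q : Fin (m + 1) → ℝ} (h0 : p 0 = q 0) (ht : Fin.tail p = Fin.tail q) :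
    p = q := by
  funext j
  refine Fin.cases h0 (fun i => ?_) j
  exact congrFun ht i

theorem tail_add (p q : Fin (m + 1) → ℝ) : Fin.tail (p + q) = Fin.tail p + Fin.tail q := rfl

theorem tail_sub (p q : Fin (m + 1) → ℝ) : Fin.tail (p - q) = Fin.tail p - Fin.tail q := rfl

theorem tail_smul (r : ℝ) (p : Fin (m + 1) → ℝ) : Fin.tail (r • p) = r • Fin.tail p := rfl

theorem bordered_mulVec_zero (a : ℝ) (v : Fin m → ℝ) (M : Matrix (Fin m) (Fin m) ℝ)
    (p : Fin (m + 1) → ℝ) :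
    (bordered a v M *ᵥ p) 0 = a * p 0 + v ⬝ᵥ Fin.tail p := by
  simp [Matrix.mulVec, dotProduct, Fin.sum_univ_succ, bordered, Fin.tail]

theorem tail_bordered_mulVec (a : ℝ) (v : Fin m → ℝ) (M : Matrix (Fin m) (Fin m) ℝ)
    (p : Fin (m + 1) → ℝ) :
    Fin.tail (bordered a v M *ᵥ p) = p 0 • v + M *ᵥ Fin.tail p := by
  funext i
  simp [Matrix.mulVec, dotProduct, Fin.sum_univ_succ, bordered, Fin.tail, mul_comm]

theorem arrow_mulVec_zero (p q : Fin (m + 1) → ℝ) : (arrow p *ᵥ q) 0 = p ⬝ᵥ q := by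
  rw [arrow, bordered_mulVec_zero, dot_eq]

theorem tail_arrow_mulVec (p q : Fin (m + 1) → ℝ) :
    Fin.tail (arrow p *ᵥ q) = q 0 • Fin.tail p + p 0 • Fin.tail q := by
  rw [arrow, tail_bordered_mulVec, Matrix.smul_mulVec, Matrix.one_mulVec]

theorem lorentz_mulVec_zero (q : Fin (m + 1) → ℝ) : (lorentz m *ᵥ q) 0 = q 0 := by
  rw [lorentz, bordered_mulVec_zero]; simp

theorem tail_lorentz_mulVec (q : Fin (m + 1) → ℝ) :
    Fin.tail (lorentz m *ᵥ q) = -Fin.tail q := by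
  rw [lorentz, tail_bordered_mulVec]; simp [Matrix.neg_mulVec]

theorem lorentz_mul_self : lorentz m * lorentz m = 1 := by
  refine Matrix.ext_of_mulVec_single fun j => ?_
  rw [← Matrix.mulVec_mulVec, Matrix.one_mulVec]
  apply ext_tail
  · rw [lorentz_mulVec_zero, lorentz_mulVec_zero]
  · rw [tail_lorentz_mulVec, tail_lorentz_mulVec, neg_neg]

theorem bordered_transpose (a : ℝ) (v : Fin m → ℝ) (M : Matrix (Fin m) (Fin m) ℝ) :
    (bordered a v M)ᵀ = bordered a v Mᵀ := by
  ext i j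
  refine Fin.cases ?_ (fun i => ?_) i <;> refine Fin.cases ?_ (fun j => ?_) j <;>
    simp [bordered]

theorem lorentz_transpose : (lorentz m)ᵀ = lorentz m := by
  rw [lorentz, bordered_transpose]; simp

theorem tBlock_transpose (u : Fin (m + 1) → ℝ) : (tBlock u)ᵀ = tBlock u := by
  rw [tBlock, bordered_transpose]
  congr 1
  simp [Matrix.transpose_vecMulVec]

theorem tBlock_mulVec_zero (u q : Fin (m + 1) → ℝ) : (tBlock u *ᵥ q) 0 = u ⬝ᵥ q := by
  rw [tBlock, bordered_mulVec_zero, dot_eq]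

theorem tail_tBlock_mulVec (u q : Fin (m + 1) → ℝ) :
    Fin.tail (tBlock u *ᵥ q) = (q 0 + (Fin.tail u ⬝ᵥ Fin.tail q) / (beta u + u 0)) • Fin.tail u
      + beta u • Fin.tail q := by
  rw [tBlock, tail_bordered_mulVec]
  funext i
  simp [Matrix.add_mulVec, Matrix.smul_mulVec, Matrix.vecMulVec_mulVec]
  ring

/-- The quadratic form of the Lorentz matrix. -/
def lorentzSq (p : Fin (m + 1) → ℝ) : ℝ := p 0 ^ 2 - Fin.tail p ⬝ᵥ Fin.tail p

/-- The interior of a single second-order cone. -/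
def InCone (p : Fin (m + 1) → ℝ) : Prop := 0 < p 0 ∧ 0 < lorentzSq p

/-- The unit element of a single block. -/
def blockUnit (m : ℕ) : Fin (m + 1) → ℝ := fun j => if j = 0 then 1 else 0

theorem blockUnit_zero : blockUnit m 0 = 1 := by simp [blockUnit]

theorem tail_blockUnit : Fin.tail (blockUnit m) = 0 := by
  funext i; simp [blockUnit, Fin.tail]

theorem dot_lorentz (p : Fin (m + 1) → ℝ) : p ⬝ᵥ (lorentz m *ᵥ p) = lorentzSq p := by
  rw [dot_eq, lorentz_mulVec_zero, tail_lorentz_mulVec, dotProduct_neg, lorentzSq]; ring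

theorem lorentzSq_lorentz (p : Fin (m + 1) → ℝ) : lorentzSq (lorentz m *ᵥ p) = lorentzSq p := by
  rw [lorentzSq, lorentz_mulVec_zero, tail_lorentz_mulVec, neg_dotProduct, dotProduct_neg,
    neg_neg, lorentzSq]

theorem InCone.lorentz_mulVec {p : Fin (m + 1) → ℝ} (hp : InCone p) : InCone (lorentz m *ᵥ p) :=
  ⟨by rw [lorentz_mulVec_zero]; exact hp.1, by rw [lorentzSq_lorentz]; exact hp.2⟩

theorem inCone_iff (p : Fin (m + 1) → ℝ) : InCone p ↔ eucNorm (Fin.tail p) < p 0 := by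
  have h := eucNorm_nonneg (Fin.tail p)
  unfold InCone lorentzSq
  rw [← eucNorm_sq]
  constructor
  · rintro ⟨h0, h1⟩
    exact lt_of_pow_lt_pow_left₀ 2 h0.le (by linarith)
  · intro h1
    exact ⟨by linarith, by nlinarith⟩

theorem beta_sq {u : Fin (m + 1) → ℝ} (hu : InCone u) : beta u ^ 2 = lorentzSq u := by
  have := hu.2
  unfold lorentzSq at this
  rw [beta, eucNorm_sq, Real.sq_sqrt this.le, lorentzSq]

theorem beta_pos {u : Fin (m + 1) → ℝ} (hu : InCone u) : 0 < beta u := by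
  have := hu.2
  unfold lorentzSq at this
  rw [beta, eucNorm_sq]
  exact Real.sqrt_pos.2 this

theorem beta_lorentz (u : Fin (m + 1) → ℝ) : beta (lorentz m *ᵥ u) = beta u := by
  simp only [beta, eucNorm_sq, lorentz_mulVec_zero, tail_lorentz_mulVec, neg_dotProduct,
    dotProduct_neg, neg_neg]

theorem InCone.dot_pos {p q : Fin (m + 1) → ℝ} (hp : InCone p) (hq : InCone q) :
    0 < p ⬝ᵥ q := by
  have h := dotProduct_sq_le (Fin.tail p) (Fin.tail q)
  obtain ⟨p0, hp⟩ := hp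
  obtain ⟨q0, hq⟩ := hq
  unfold lorentzSq at hp hq
  have hpp := dotProduct_self_nonneg' (Fin.tail p)
  have hqq := dotProduct_self_nonneg' (Fin.tail q)
  rw [dot_eq]
  have : (Fin.tail p ⬝ᵥ Fin.tail q) ^ 2 < (p 0 * q 0) ^ 2 := by
    refine h.trans_lt ?_
    rw [mul_pow]
    have := pow_pos p0 2
    have := pow_pos q0 2
    nlinarith
  have := abs_lt_of_sq_lt_sq this (by positivity)
  linarith [(abs_lt.1 this).1]

/-- `T_u` is a multiple of a Lorentz transformation. -/
theorem tBlock_lorentz_tBlock {u : Fin (m + 1) → ℝ} (hu : InCone u) :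
    tBlock u * lorentz m * tBlock u = lorentzSq u • lorentz m := by
  have hb := beta_pos hu
  have hb2 := beta_sq hu
  have h0 := hu.1
  refine Matrix.ext_of_mulVec_single fun j => ?_
  generalize (Pi.single j 1 : Fin (m + 1) → ℝ) = q
  rw [← Matrix.mulVec_mulVec, ← Matrix.mulVec_mulVec, Matrix.smul_mulVec]
  have hX : Fin.tail u ⬝ᵥ Fin.tail u = u 0 ^ 2 - beta u ^ 2 := by
    rw [hb2, lorentzSq]; ring
  have hne : beta u + u 0 ≠ 0 := by positivity
  apply ext_tail
  · rw [tBlock_mulVec_zero, dot_eq, lorentz_mulVec_zero, tBlock_mulVec_zero, tail_lorentz_mulVec,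
      tail_tBlock_mulVec, dotProduct_neg, dotProduct_add, dotProduct_smul, dotProduct_smul, hX,
      dot_eq]
    simp only [smul_eq_mul, Pi.smul_apply, lorentz_mulVec_zero, ← hb2]
    field_simp
    ring
  · rw [tail_tBlock_mulVec, lorentz_mulVec_zero, tBlock_mulVec_zero, tail_lorentz_mulVec,
      tail_tBlock_mulVec, tail_smul, tail_lorentz_mulVec, dotProduct_neg, dotProduct_add,
      dotProduct_smul, dotProduct_smul, hX, dot_eq, ← hb2]
    funext i
    simp only [smul_eq_mul, Pi.smul_apply, Pi.add_apply, Pi.neg_apply]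
    field_simp
    ring

/-- The inverse of `T_u`. -/
def tInv (u : Fin (m + 1) → ℝ) : Matrix (Fin (m + 1)) (Fin (m + 1)) ℝ :=
  (lorentzSq u)⁻¹ • (lorentz m * tBlock u * lorentz m)

theorem tInv_mul_tBlock {u : Fin (m + 1) → ℝ} (hu : InCone u) : tInv u * tBlock u = 1 := by
  rw [tInv, Matrix.smul_mul, mul_assoc, mul_assoc, ← mul_assoc (tBlock u),
    tBlock_lorentz_tBlock hu, Matrix.mul_smul, lorentz_mul_self, smul_smul,
    inv_mul_cancel₀ hu.2.ne', one_smul]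

theorem tBlock_mul_tInv {u : Fin (m + 1) → ℝ} (hu : InCone u) : tBlock u * tInv u = 1 :=
  mul_eq_one_comm.1 (tInv_mul_tBlock hu)

theorem tInv_transpose (u : Fin (m + 1) → ℝ) : (tInv u)ᵀ = tInv u := by
  simp [tInv, Matrix.transpose_mul, lorentz_transpose, tBlock_transpose, mul_assoc]

theorem tBlock_lorentz {u : Fin (m + 1) → ℝ} :
    tBlock (lorentz m *ᵥ u) = lorentz m * tBlock u * lorentz m := by
  refine Matrix.ext_of_mulVec_single fun j => ?_
  generalize (Pi.single j 1 : Fin (m + 1) → ℝ) = q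
  rw [← Matrix.mulVec_mulVec, ← Matrix.mulVec_mulVec]
  apply ext_tail
  · rw [tBlock_mulVec_zero, dot_eq, lorentz_mulVec_zero, lorentz_mulVec_zero, tBlock_mulVec_zero,
      dot_eq, tail_lorentz_mulVec, tail_lorentz_mulVec, lorentz_mulVec_zero]
    simp
  · rw [tail_tBlock_mulVec, tail_lorentz_mulVec, tail_lorentz_mulVec, tail_tBlock_mulVec,
      beta_lorentz, lorentz_mulVec_zero, lorentz_mulVec_zero, tail_lorentz_mulVec]
    funext i
    simp
    ring

theorem tBlock_mulVec_unit (u : Fin (m + 1) → ℝ) : tBlock u *ᵥ blockUnit m = u := by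
  apply ext_tail
  · rw [tBlock_mulVec_zero, dot_eq, tail_blockUnit, blockUnit_zero]; simp
  · rw [tail_tBlock_mulVec, tail_blockUnit, blockUnit_zero]; simp

/-- Applied both to `T_u` and to transposes of scaled frames, which are all multiples of Lorentz
transformations. -/
theorem lorentzSq_mulVec {B : Matrix (Fin (m + 1)) (Fin (m + 1)) ℝ} {θ : ℝ}
    (hB : Bᵀ * lorentz m * B = θ • lorentz m) (p : Fin (m + 1) → ℝ) :
    lorentzSq (B *ᵥ p) = θ * lorentzSq p := by
  have h := congrArg (fun M => p ⬝ᵥ (M *ᵥ p)) hB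
  simp only [← Matrix.mulVec_mulVec, Matrix.smul_mulVec, dotProduct_smul, dot_lorentz] at h
  rw [← dot_lorentz, ← smul_eq_mul, ← h, Matrix.mulVec_transpose, dotProduct_comm p,
    ← Matrix.dotProduct_mulVec, dotProduct_comm]

theorem lorentzSq_tBlock {u : Fin (m + 1) → ℝ} (hu : InCone u) (p : Fin (m + 1) → ℝ) :
    lorentzSq (tBlock u *ᵥ p) = lorentzSq u * lorentzSq p :=
  lorentzSq_mulVec (by rw [tBlock_transpose, tBlock_lorentz_tBlock hu]) p

theorem InCone.tBlock_mulVec {u p : Fin (m + 1) → ℝ} (hu : InCone u) (hp : InCone p) :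
    InCone (tBlock u *ᵥ p) :=
  ⟨by rw [tBlock_mulVec_zero]; exact hu.dot_pos hp,
    by rw [lorentzSq_tBlock hu]; exact mul_pos hu.2 hp.2⟩

theorem lorentzSq_smul (r : ℝ) (p : Fin (m + 1) → ℝ) :
    lorentzSq (r • p) = r ^ 2 * lorentzSq p := by
  simp only [lorentzSq, tail_smul, smul_dotProduct, dotProduct_smul, Pi.smul_apply, smul_eq_mul]
  ring

/-- The inverse of `T_u` is a positive multiple of `T` at the reflected vector `(u₁, -u₂)`, which is
again interior. -/
theorem InCone.tInv_mulVec {u p : Fin (m + 1) → ℝ} (hu : InCone u) (hp : InCone p) :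
    InCone (tInv u *ᵥ p) := by
  have h := hu.lorentz_mulVec.tBlock_mulVec hp
  have hr : 0 < (lorentzSq u)⁻¹ := inv_pos.2 hu.2
  rw [tInv, ← tBlock_lorentz, Matrix.smul_mulVec]
  refine ⟨mul_pos hr h.1, ?_⟩
  rw [lorentzSq_smul]
  exact mul_pos (pow_pos hr 2) h.2

theorem dot_tBlock_tInv {u : Fin (m + 1) → ℝ} (hu : InCone u) (p q : Fin (m + 1) → ℝ) :
    (tInv u *ᵥ p) ⬝ᵥ (tBlock u *ᵥ q) = p ⬝ᵥ q := by
  rw [← Matrix.vecMul_transpose, tInv_transpose, ← Matrix.dotProduct_mulVec, Matrix.mulVec_mulVec,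
    tInv_mul_tBlock hu, Matrix.one_mulVec]

/-- The squared distance of `T_u q` to `t e`. -/
theorem dot_self_tBlock_sub {u : Fin (m + 1) → ℝ} (hu : InCone u) (q : Fin (m + 1) → ℝ) (t : ℝ) :
    (tBlock u *ᵥ q - t • blockUnit m) ⬝ᵥ (tBlock u *ᵥ q - t • blockUnit m)
      = (u ⬝ᵥ q - t) ^ 2 + (u ⬝ᵥ q) ^ 2 - lorentzSq u * lorentzSq q := by
  rw [← lorentzSq_tBlock hu, lorentzSq, dot_eq, tail_sub, tail_smul, tail_blockUnit, smul_zero,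
    sub_zero, Pi.sub_apply, Pi.smul_apply, blockUnit_zero, tBlock_mulVec_zero, smul_eq_mul]
  ring

/-- The left side is the squared distance of `T_p q` to `t e` for interior `p`. The two sides differ
by the Cauchy-Schwarz defect `‖p̄‖² ‖q̄‖² - (p̄·q̄)²` of the tails. -/
theorem arrow_sub_bound (p q : Fin (m + 1) → ℝ) (t : ℝ) :
    (p ⬝ᵥ q - t) ^ 2 + (p ⬝ᵥ q) ^ 2 - lorentzSq p * lorentzSq q
      ≤ (arrow p *ᵥ q - t • blockUnit m) ⬝ᵥ (arrow p *ᵥ q - t • blockUnit m) := by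
  have h := dotProduct_sq_le (Fin.tail p) (Fin.tail q)
  rw [dot_eq (arrow p *ᵥ q - t • blockUnit m), tail_sub, tail_smul, tail_blockUnit, smul_zero,
    sub_zero, Pi.sub_apply, Pi.smul_apply, blockUnit_zero, arrow_mulVec_zero, tail_arrow_mulVec]
  simp only [dot_eq p q, lorentzSq, add_dotProduct, dotProduct_add, smul_dotProduct,
    dotProduct_smul, smul_eq_mul, dotProduct_comm (Fin.tail q) (Fin.tail p)]
  nlinarith

theorem arrow_norm_bound (p q : Fin (m + 1) → ℝ) :
    (arrow p *ᵥ q) ⬝ᵥ (arrow p *ᵥ q) ≤ 2 * (p ⬝ᵥ p) * (q ⬝ᵥ q) := by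
  have h := dotProduct_sq_le (Fin.tail p) (Fin.tail q)
  have h2 := dotProduct_self_nonneg' (p 0 • Fin.tail q - q 0 • Fin.tail p)
  rw [dot_eq (arrow p *ᵥ q), arrow_mulVec_zero, tail_arrow_mulVec]
  simp only [dot_eq p q, dot_eq p p, dot_eq q q, add_dotProduct, dotProduct_add, smul_dotProduct,
    dotProduct_smul, smul_eq_mul, dotProduct_comm (Fin.tail q) (Fin.tail p), sub_dotProduct,
    dotProduct_sub] at h2 ⊢
  nlinarith [sq_nonneg (p 0 * q 0 - Fin.tail p ⬝ᵥ Fin.tail q)]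

/-- By the parallelogram law the left side is at most `2 ((n·p)² ‖q‖² + (n·q)² ‖p‖²)`;
Cauchy-Schwarz with `‖n‖ ≤ 1` does the rest. This is the only information about the scaling that the
size estimates need. -/
theorem skew_norm_bound {n p q : Fin m → ℝ} (hn : n ⬝ᵥ n ≤ 1) :
    ((n ⬝ᵥ p) • q - (n ⬝ᵥ q) • p) ⬝ᵥ ((n ⬝ᵥ p) • q - (n ⬝ᵥ q) • p)
      ≤ 4 * (q ⬝ᵥ q) * (p ⬝ᵥ p) := by
  have hp := dotProduct_self_nonneg' p
  have hq := dotProduct_self_nonneg' q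
  have h1 : (n ⬝ᵥ p) ^ 2 ≤ p ⬝ᵥ p := by nlinarith [dotProduct_sq_le n p]
  have h2 : (n ⬝ᵥ q) ^ 2 ≤ q ⬝ᵥ q := by nlinarith [dotProduct_sq_le n q]
  have h3 := dotProduct_self_nonneg' ((n ⬝ᵥ p) • q + (n ⬝ᵥ q) • p)
  simp only [add_dotProduct, dotProduct_add, smul_dotProduct,
    dotProduct_smul, smul_eq_mul, dotProduct_comm q p, sub_dotProduct,
    dotProduct_sub] at h3 ⊢
  nlinarith [mul_le_mul_of_nonneg_right h1 hq, mul_le_mul_of_nonneg_right h2 hp]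

/-- `arrow p q` in terms of linear operations. -/
theorem arrow_mulVec_eq (p q : Fin (m + 1) → ℝ) :
    arrow p *ᵥ q = p 0 • q + q 0 • p + (p ⬝ᵥ q - 2 * (p 0 * q 0)) • blockUnit m := by
  apply ext_tail
  · rw [arrow_mulVec_zero]; simp [blockUnit_zero]; ring
  · rw [tail_arrow_mulVec, tail_add, tail_add, tail_smul, tail_smul, tail_smul, tail_blockUnit,
      smul_zero, add_zero, add_comm]

/-- Written as `I = 2 e eᵀ - Q`, this expresses `BᵀB` through `BᵀQB` and the first row of `B`. -/
theorem lorentz_eq : lorentz m = (2 : ℝ) • Matrix.vecMulVec (blockUnit m) (blockUnit m) - 1 := by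
  refine Matrix.ext_of_mulVec_single fun j => ?_
  generalize (Pi.single j 1 : Fin (m + 1) → ℝ) = q
  rw [Matrix.sub_mulVec, Matrix.smul_mulVec, Matrix.vecMulVec_mulVec, Matrix.one_mulVec]
  have h : blockUnit m ⬝ᵥ q = q 0 := by
    rw [dot_eq, blockUnit_zero, tail_blockUnit]; simp
  apply ext_tail
  · rw [lorentz_mulVec_zero]; simp [h, blockUnit_zero]; ring
  · rw [tail_lorentz_mulVec, tail_sub, tail_smul]
    have : Fin.tail (MulOpposite.op (blockUnit m ⬝ᵥ q) • blockUnit m) = 0 := by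
      funext i; simp [Fin.tail, blockUnit]
    rw [this]; simp

theorem transpose_mulVec_unit (B : Matrix (Fin (m + 1)) (Fin (m + 1)) ℝ) :
    Bᵀ *ᵥ blockUnit m = B 0 := by
  funext i
  simp [Matrix.mulVec, dotProduct, blockUnit]

/-! ### Multiples of Lorentz transformations and the pulled-back complementarity equation. -/

section Conformal

variable {B F : Matrix (Fin (m + 1)) (Fin (m + 1)) ℝ} {θ : ℝ}

theorem mul_lorentz_transpose (hθ : 0 < θ) (hB : Bᵀ * lorentz m * B = θ • lorentz m) :
    B * lorentz m * Bᵀ = θ • lorentz m := by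
  have h1 : (θ⁻¹ • (lorentz m * Bᵀ * lorentz m)) * B = 1 := by
    rw [Matrix.smul_mul, mul_assoc, mul_assoc, ← mul_assoc Bᵀ, hB, Matrix.mul_smul,
      lorentz_mul_self, smul_smul, inv_mul_cancel₀ hθ.ne', one_smul]
  have h2 := mul_eq_one_comm.1 h1
  have h3 := congrArg (fun M => θ • (M * lorentz m)) h2
  simpa [Matrix.mul_assoc, lorentz_mul_self, hθ.ne'] using h3

theorem lorentzSq_row (hθ : 0 < θ) (hB : Bᵀ * lorentz m * B = θ • lorentz m) :
    lorentzSq (B 0) = θ := by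
  have h := lorentzSq_mulVec (B := Bᵀ) (θ := θ)
    (by rw [Matrix.transpose_transpose, mul_lorentz_transpose hθ hB]) (blockUnit m)
  rw [transpose_mulVec_unit] at h
  rw [h, lorentzSq, blockUnit_zero, tail_blockUnit]; simp

theorem inverse_transpose_eq (hθ : 0 < θ) (hB : Bᵀ * lorentz m * B = θ • lorentz m)
    (hF : Fᵀ * B = 1) : F = θ⁻¹ • (lorentz m * B * lorentz m) := by
  have h1 : (θ⁻¹ • (lorentz m * Bᵀ * lorentz m)) * B = 1 := by
    rw [Matrix.smul_mul, mul_assoc, mul_assoc, ← mul_assoc Bᵀ, hB, Matrix.mul_smul,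
      lorentz_mul_self, smul_smul, inv_mul_cancel₀ hθ.ne', one_smul]
  have h2 : Fᵀ = θ⁻¹ • (lorentz m * Bᵀ * lorentz m) :=
    (left_inv_eq_right_inv hF (mul_eq_one_comm.1 h1))
  have h3 := congrArg Matrix.transpose h2
  simpa [Matrix.transpose_mul, lorentz_transpose, mul_assoc] using h3

theorem transpose_mul_self_eq (hB : Bᵀ * lorentz m * B = θ • lorentz m)
    (q : Fin (m + 1) → ℝ) :
    Bᵀ *ᵥ (B *ᵥ q) = (2 * (B 0 ⬝ᵥ q)) • B 0 - θ • (lorentz m *ᵥ q) := by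
  have h := congrArg (fun M => M *ᵥ q) hB
  simp only [← Matrix.mulVec_mulVec, Matrix.smul_mulVec] at h
  rw [← h, lorentz_eq, Matrix.sub_mulVec, Matrix.smul_mulVec, Matrix.vecMulVec_mulVec,
    Matrix.one_mulVec, Matrix.mulVec_sub, Matrix.mulVec_smul, op_smul_eq_smul,
    Matrix.mulVec_smul, transpose_mulVec_unit, smul_smul]
  have : blockUnit m ⬝ᵥ B *ᵥ q = B 0 ⬝ᵥ q := by
    rw [dot_eq, blockUnit_zero, tail_blockUnit]; simp [Matrix.mulVec]
  rw [this]; abel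

/-- The Jordan product of transformed vectors, pulled back by the transpose. -/
theorem transpose_mulVec_arrow (hθ : 0 < θ) (hB : Bᵀ * lorentz m * B = θ • lorentz m)
    (hF : Fᵀ * B = 1) (w u : Fin (m + 1) → ℝ) :
    Bᵀ *ᵥ (arrow (F *ᵥ w) *ᵥ (B *ᵥ u))
      = (B 0 ⬝ᵥ u) • w - (B 0 ⬝ᵥ (lorentz m *ᵥ w)) • (lorentz m *ᵥ u) + (w ⬝ᵥ u) • B 0 := by
  have hBF : Bᵀ * F = 1 := by
    have := congrArg Matrix.transpose hF
    simpa [Matrix.transpose_mul] using this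
  have h0 : (F *ᵥ w) 0 = θ⁻¹ * (B 0 ⬝ᵥ (lorentz m *ᵥ w)) := by
    rw [inverse_transpose_eq hθ hB hF, Matrix.smul_mulVec, ← Matrix.mulVec_mulVec,
      ← Matrix.mulVec_mulVec, Pi.smul_apply, lorentz_mulVec_zero]
    rfl
  have h1 : (B *ᵥ u) 0 = B 0 ⬝ᵥ u := rfl
  have h2 : (F *ᵥ w) ⬝ᵥ (B *ᵥ u) = w ⬝ᵥ u := by
    rw [← Matrix.vecMul_transpose, ← Matrix.dotProduct_mulVec, Matrix.mulVec_mulVec, hF,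
      Matrix.one_mulVec]
  rw [arrow_mulVec_eq, Matrix.mulVec_add, Matrix.mulVec_add, Matrix.mulVec_smul,
    Matrix.mulVec_smul, Matrix.mulVec_smul, transpose_mulVec_unit, transpose_mul_self_eq hB,
    Matrix.mulVec_mulVec, hBF, Matrix.one_mulVec, h0, h1, h2]
  funext i
  simp only [Pi.add_apply, Pi.sub_apply, Pi.smul_apply, smul_eq_mul]
  field_simp
  ring

/-- A scaled complementarity equation in the frame in which the primal block is the unit. -/
theorem block_equation (hθ : 0 < θ) (hB : Bᵀ * lorentz m * B = θ • lorentz m)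
    (hF : Fᵀ * B = 1) {w u v : Fin (m + 1) → ℝ} {ξ : ℝ}
    (h : arrow (B *ᵥ blockUnit m) *ᵥ (F *ᵥ v) + arrow (F *ᵥ w) *ᵥ (B *ᵥ u)
      = ξ • blockUnit m) :
    ∃ n : Fin m → ℝ, n ⬝ᵥ n ≤ 1 ∧ v 0 + w ⬝ᵥ u = ξ ∧
      Fin.tail v + Fin.tail (arrow w *ᵥ u)
        = (n ⬝ᵥ Fin.tail u) • Fin.tail w - (n ⬝ᵥ Fin.tail w) • Fin.tail u := by
  -- Commuting the Jordan product puts both summands into the form `F · ∘ B ·` that the pullback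
  -- formula handles.
  have hcomm : arrow (B *ᵥ blockUnit m) *ᵥ (F *ᵥ v) = arrow (F *ᵥ v) *ᵥ (B *ᵥ blockUnit m) := by
    rw [arrow_mulVec_eq, arrow_mulVec_eq, dotProduct_comm, mul_comm ((F *ᵥ v) 0)]
    abel
  have hr := lorentzSq_row hθ hB
  have h' := congrArg (fun q => Bᵀ *ᵥ q) h
  simp only [hcomm, Matrix.mulVec_add, transpose_mulVec_arrow hθ hB hF, Matrix.mulVec_smul,
    transpose_mulVec_unit] at h'
  set r := B 0 with hrdef
  have ha2 : r 0 ^ 2 = θ + Fin.tail r ⬝ᵥ Fin.tail r := by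
    rw [← hr, lorentzSq]; ring
  have hbb := dotProduct_self_nonneg' (Fin.tail r)
  have ha : r 0 ≠ 0 := by
    intro h0; rw [h0] at ha2; nlinarith
  have hz := congrFun h' 0
  have ht := congrArg Fin.tail h'
  simp only [Pi.add_apply, Pi.sub_apply, Pi.smul_apply, smul_eq_mul, lorentz_mulVec_zero,
    blockUnit_zero, tail_add, tail_sub, tail_smul, tail_lorentz_mulVec, tail_blockUnit,
    dot_eq r, dotProduct_neg, dot_eq v (blockUnit m), dotProduct_zero] at hz ht
  have hdot := congrArg (fun q => Fin.tail r ⬝ᵥ q) ht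
  simp only [dotProduct_add, dotProduct_sub, dotProduct_smul, dotProduct_neg, smul_eq_mul,
    dotProduct_zero] at hdot
  have hg : v 0 + w ⬝ᵥ u = ξ := by
    -- Pairing the pulled-back equation with `Q r` isolates the head equation, because `r` has
    -- Lorentz form `θ`.
    have : θ * (v 0 + w ⬝ᵥ u - ξ) = 0 := by
      have e1 : θ = r 0 ^ 2 - Fin.tail r ⬝ᵥ Fin.tail r := by linarith
      rw [e1]
      linear_combination r 0 * hz - hdot
    rcases mul_eq_zero.1 this with h | h
    · exact absurd h hθ.ne'
    · linarith
  -- The slope of the first row of `B`; its norm is at most one because `r₁² = θ + ‖r̄‖²` with `θ >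
  -- 0`.
  refine ⟨-(r 0)⁻¹ • Fin.tail r, ?_, hg, ?_⟩
  · rw [smul_dotProduct, dotProduct_smul, smul_eq_mul, smul_eq_mul]
    have : -(r 0)⁻¹ * (-(r 0)⁻¹ * (Fin.tail r ⬝ᵥ Fin.tail r))
        = (Fin.tail r ⬝ᵥ Fin.tail r) / r 0 ^ 2 := by field_simp
    rw [this, div_le_one (by positivity)]
    linarith
  · rw [tail_arrow_mulVec]
    funext i
    have hi := congrFun ht i
    simp only [Pi.add_apply, Pi.sub_apply, Pi.smul_apply, smul_eq_mul, Pi.neg_apply,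
      Pi.zero_apply, smul_dotProduct] at hi ⊢
    apply mul_left_cancel₀ ha
    rw [← hg] at hi
    field_simp
    linear_combination hi

end Conformal

end Block

/-! ### Block vectors, scaling matrices and the augmented norm. -/

section Blocks

variable {k : ℕ} {d : Fin k → ℕ}

theorem block_add (a b : Vec d) (i : Fin k) : block (a + b) i = block a i + block b i := rfl

theorem block_sub (a b : Vec d) (i : Fin k) : block (a - b) i = block a i - block b i := rfl

theorem block_smul (r : ℝ) (a : Vec d) (i : Fin k) : block (r • a) i = r • block a i := rfl

theorem block_unit (i : Fin k) : block (unit d) i = blockUnit (d i) := rfl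

theorem ext_block {a b : Vec d} (h : ∀ i, block a i = block b i) : a = b := by
  funext q
  exact congrFun (h q.1) q.2

theorem block_blockDiagonal'_mulVec (M : ∀ i, Matrix (Fin (d i + 1)) (Fin (d i + 1)) ℝ)
    (v : Vec d) (i : Fin k) :
    block (Matrix.blockDiagonal' M *ᵥ v) i = M i *ᵥ block v i := by
  funext j
  simp only [block, Matrix.mulVec, dotProduct, Fintype.sum_sigma]
  rw [Finset.sum_eq_single i]
  · simp [Matrix.blockDiagonal'_apply_eq]
  · intro i' _ hi
    exact Finset.sum_eq_zero fun j' _ => by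
      rw [Matrix.blockDiagonal'_apply_ne _ _ _ hi.symm, zero_mul]
  · simp

theorem block_mat_mulVec (a b : Vec d) (i : Fin k) :
    block (mat a *ᵥ b) i = arrow (block a i) *ᵥ block b i :=
  block_blockDiagonal'_mulVec _ _ _

theorem block_tMat_mulVec (a b : Vec d) (i : Fin k) :
    block (tMat a *ᵥ b) i = tBlock (block a i) *ᵥ block b i :=
  block_blockDiagonal'_mulVec _ _ _

theorem dot_blocks (a b : Vec d) : a ⬝ᵥ b = ∑ i, block a i ⬝ᵥ block b i := by
  simp only [dotProduct, Fintype.sum_sigma, block]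

theorem mat_mulVec_unit (a : Vec d) : mat a *ᵥ unit d = a := by
  refine ext_block fun i => ?_
  rw [block_mat_mulVec, block_unit]
  apply ext_tail
  · rw [arrow_mulVec_zero, dot_eq, blockUnit_zero, tail_blockUnit]; simp
  · rw [tail_arrow_mulVec, blockUnit_zero, tail_blockUnit]; simp

/-- From `GᵀQG = Q` one gets `G⁻¹ = Q Gᵀ Q`, so the blocks of `D⁻ᵀ` are `θ⁻¹ Q G Q`, again multiples
of Lorentz transformations. -/
theorem scalings_blocks {D : Matrix (Idx d) (Idx d) ℝ} (hD : D ∈ scalings d) :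
    ∃ M N : ∀ i, Matrix (Fin (d i + 1)) (Fin (d i + 1)) ℝ,
      D = Matrix.blockDiagonal' M ∧ (D⁻¹)ᵀ = Matrix.blockDiagonal' N ∧
      ∀ i, (M i)ᵀ * N i = 1 ∧
        ∃ θ : ℝ, 0 < θ ∧ (N i)ᵀ * lorentz (d i) * N i = θ • lorentz (d i) := by
  obtain ⟨θ, G, hθ, hG, rfl⟩ := hD
  have hinv : ∀ i, G i * (lorentz (d i) * (G i)ᵀ * lorentz (d i)) = 1 := fun i =>
    mul_eq_one_comm.1 (by rw [mul_assoc, mul_assoc, ← mul_assoc (G i)ᵀ, hG, lorentz_mul_self])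
  refine ⟨fun i => θ i • G i, fun i => (θ i)⁻¹ • (lorentz (d i) * G i * lorentz (d i)), rfl, ?_,
    fun i => ⟨?_, ((θ i)⁻¹) ^ 2, by have := hθ i; positivity, ?_⟩⟩
  · have h : (Matrix.blockDiagonal' fun i => θ i • G i)⁻¹ = Matrix.blockDiagonal' fun i =>
        (θ i)⁻¹ • (lorentz (d i) * (G i)ᵀ * lorentz (d i)) := by
      apply Matrix.inv_eq_right_inv
      rw [← Matrix.blockDiagonal'_mul, ← Matrix.blockDiagonal'_one]
      congr 1
      funext i
      rw [Matrix.smul_mul, Matrix.mul_smul, smul_smul, hinv i, mul_inv_cancel₀ (hθ i).ne',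
        one_smul]
      rfl
    rw [h, Matrix.blockDiagonal'_transpose]
    simp [Matrix.transpose_mul, lorentz_transpose, mul_assoc]
  · rw [Matrix.transpose_smul, Matrix.smul_mul, Matrix.mul_smul, smul_smul,
      mul_inv_cancel₀ (hθ i).ne', one_smul, ← mul_assoc, ← mul_assoc, hG, lorentz_mul_self]
  · rw [Matrix.transpose_smul, Matrix.transpose_mul, Matrix.transpose_mul, lorentz_transpose,
      Matrix.smul_mul, Matrix.smul_mul, Matrix.mul_smul, smul_smul, ← pow_two]
    congr 1
    calc _ = lorentz (d i) * ((G i)ᵀ * (lorentz (d i) * (lorentz (d i) * lorentz (d i))) * G i)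
          * lorentz (d i) := by simp only [mul_assoc]
      _ = _ := by rw [lorentz_mul_self, mul_one, hG, lorentz_mul_self, one_mul]

/-- The coordinates `T_x⁻¹ a` of a primal vector in the frame of `x`. -/
def hatX (x a : Vec d) : Vec d := fun q => (tInv (block x q.1) *ᵥ block a q.1) q.2

theorem block_hatX (x a : Vec d) (i : Fin k) :
    block (hatX x a) i = tInv (block x i) *ᵥ block a i := rfl

/-- The scaled complementarity equation in the frame of `x`, block by block. -/
theorem hat_equation {x s a σ : Vec d} {D : Matrix (Idx d) (Idx d) ℝ} {ξ : ℝ}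
    (hx : ∀ i, InCone (block x i)) (hD : D ∈ scalings d)
    (h : mat ((D⁻¹)ᵀ *ᵥ x) *ᵥ (D *ᵥ σ) + mat (D *ᵥ s) *ᵥ ((D⁻¹)ᵀ *ᵥ a) = ξ • unit d)
    (i : Fin k) :
    ∃ n : Fin (d i) → ℝ, n ⬝ᵥ n ≤ 1 ∧
      block x i ⬝ᵥ block σ i + block s i ⬝ᵥ block a i = ξ ∧
      Fin.tail (block (tMat x *ᵥ σ + mat (tMat x *ᵥ s) *ᵥ hatX x a) i)
        = (n ⬝ᵥ Fin.tail (block (hatX x a) i)) • Fin.tail (block (tMat x *ᵥ s) i)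
          - (n ⬝ᵥ Fin.tail (block (tMat x *ᵥ s) i)) • Fin.tail (block (hatX x a) i) := by
  obtain ⟨M, N, hM, hN, hMN⟩ := scalings_blocks hD
  obtain ⟨h1, θ, hθ, hNN⟩ := hMN i
  have hi := congrArg (fun v => block v i) h
  simp only [hN] at hi
  simp only [hM, block_add, block_mat_mulVec, block_blockDiagonal'_mulVec, block_smul,
    block_unit] at hi
  have hxi := hx i
  set X := block x i
  -- The frame change and the scaling are merged into one map `B = N T_x` with inverse transpose `F
  -- = M T_x⁻¹`.
  have hB : (N i * tBlock X)ᵀ * lorentz (d i) * (N i * tBlock X)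
      = (θ * lorentzSq X) • lorentz (d i) := by
    rw [Matrix.transpose_mul, tBlock_transpose]
    calc _ = tBlock X * ((N i)ᵀ * lorentz (d i) * N i) * tBlock X := by simp only [mul_assoc]
      _ = _ := by
        rw [hNN, Matrix.mul_smul, Matrix.smul_mul, tBlock_lorentz_tBlock hxi, smul_smul]
  have hF : (M i * tInv X)ᵀ * (N i * tBlock X) = 1 := by
    rw [Matrix.transpose_mul, tInv_transpose]
    calc _ = tInv X * ((M i)ᵀ * N i) * tBlock X := by simp only [mul_assoc]
      _ = _ := by rw [h1, mul_one, tInv_mul_tBlock hxi]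
  have hunit : (N i * tBlock X) *ᵥ blockUnit (d i) = N i *ᵥ X := by
    rw [← Matrix.mulVec_mulVec, tBlock_mulVec_unit]
  obtain ⟨n, hn, h0, ht⟩ := block_equation (mul_pos hθ hxi.2) hB hF (w := tBlock X *ᵥ block s i)
    (u := tInv X *ᵥ block a i) (v := tBlock X *ᵥ block σ i) (ξ := ξ) (by
      rw [← hi, hunit]
      simp only [Matrix.mulVec_mulVec, mul_assoc, tInv_mul_tBlock hxi, tBlock_mul_tInv hxi,
        mul_one])
  refine ⟨n, hn, ?_, ?_⟩
  · rw [← h0, tBlock_mulVec_zero, dotProduct_comm (tBlock X *ᵥ block s i), dot_tBlock_tInv hxi,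
      dotProduct_comm (block a i)]
  · rw [block_add, tail_add, block_mat_mulVec, block_tMat_mulVec, block_tMat_mulVec, block_hatX]
    exact ht

/-- A block vector extended by one scalar coordinate, with the Euclidean norm. -/
def aug (a : Vec d) (t : ℝ) : EuclideanSpace ℝ (Idx d ⊕ Unit) :=
  WithLp.toLp 2 (Sum.elim a fun _ => t)

theorem aug_add (a b : Vec d) (s t : ℝ) : aug (a + b) (s + t) = aug a s + aug b t := by
  ext q; rcases q with q | q <;> simp [aug]

theorem aug_sub (a b : Vec d) (s t : ℝ) : aug (a - b) (s - t) = aug a s - aug b t := by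
  ext q; rcases q with q | q <;> simp [aug]

theorem aug_smul (r : ℝ) (a : Vec d) (t : ℝ) : aug (r • a) (r * t) = r • aug a t := by
  ext q; rcases q with q | q <;> simp [aug]

theorem aug_zero : aug (0 : Vec d) 0 = 0 := by
  ext q; rcases q with q | q <;> simp [aug]

theorem inner_aug (a b : Vec d) (s t : ℝ) : inner ℝ (aug a s) (aug b t) = a ⬝ᵥ b + s * t := by
  simp [aug, PiLp.inner_apply, dotProduct, mul_comm]

theorem norm_aug_sq (a : Vec d) (t : ℝ) :
    ‖aug a t‖ ^ 2 = ∑ i, block a i ⬝ᵥ block a i + t ^ 2 := by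
  rw [← real_inner_self_eq_norm_sq, inner_aug, dot_blocks, pow_two]

theorem block_dot_le_norm_aug (a : Vec d) (t : ℝ) (i : Fin k) :
    block a i ⬝ᵥ block a i ≤ ‖aug a t‖ ^ 2 := by
  rw [norm_aug_sq]
  have := Finset.single_le_sum (f := fun i => block a i ⬝ᵥ block a i)
    (fun i _ => dotProduct_self_nonneg' _) (Finset.mem_univ i)
  nlinarith [sq_nonneg t]

theorem scalar_sq_le_norm_aug (a : Vec d) (t : ℝ) : t ^ 2 ≤ ‖aug a t‖ ^ 2 := by
  rw [norm_aug_sq]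
  have := Finset.sum_nonneg (s := Finset.univ) (f := fun i => block a i ⬝ᵥ block a i)
    (fun i _ => dotProduct_self_nonneg' _)
  linarith

theorem norm_aug_le {a b : Vec d} {s t C : ℝ} (hC : 0 ≤ C)
    (h : ∀ i, block a i ⬝ᵥ block a i ≤ C ^ 2 * (block b i ⬝ᵥ block b i))
    (ht : s ^ 2 ≤ C ^ 2 * t ^ 2) : ‖aug a s‖ ≤ C * ‖aug b t‖ := by
  refine le_of_sq_le_sq ?_ (by positivity)
  rw [mul_pow, norm_aug_sq, norm_aug_sq, mul_add, Finset.mul_sum]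
  exact add_le_add (Finset.sum_le_sum fun i _ => h i) ht

/-- The `√2` comes from the single-block bound on the Jordan product; it matches the `√2` in the
neighborhood. -/
theorem norm_aug_mat_mulVec_le (a b : Vec d) (s t : ℝ) :
    ‖aug (mat a *ᵥ b) (s * t)‖ ≤ Real.sqrt 2 * ‖aug a s‖ * ‖aug b t‖ := by
  have h2 : (Real.sqrt 2 * ‖aug a s‖) ^ 2 = 2 * ‖aug a s‖ ^ 2 := by
    rw [mul_pow, Real.sq_sqrt (by norm_num)]
  refine norm_aug_le (by positivity) (fun i => ?_) ?_
  · rw [h2, block_mat_mulVec]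
    refine (arrow_norm_bound _ _).trans ?_
    have := block_dot_le_norm_aug a s i
    have hb := dotProduct_self_nonneg' (block b i)
    gcongr
  · rw [h2]
    have := scalar_sq_le_norm_aug a s
    nlinarith [mul_le_mul_of_nonneg_right this (sq_nonneg t), sq_nonneg (s * t)]

theorem mem_interior_cone {v : Vec d} : v ∈ interior (cone d) ↔ ∀ i, InCone (block v i) := by
  constructor
  · intro hv i
    rw [inCone_iff]
    have hc : Filter.Tendsto (fun t : ℝ => v - t • unit d) (nhds 0) (nhds v) := by
      have : Continuous fun t : ℝ => v - t • unit d := by fun_prop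
      simpa using this.tendsto 0
    have hev := hc.eventually (mem_interior_iff_mem_nhds.1 hv)
    obtain ⟨ε, hε, hball⟩ := Metric.eventually_nhds_iff.1 hev
    -- Moving by `-(ε / 2) e` lowers the heads and leaves the tails alone, so staying in the cone
    -- forces strict inequality.
    have hmem := hball (y := ε / 2) (by
      rw [Real.dist_eq, sub_zero, abs_of_pos (by positivity)]; linarith) i
    rw [block_sub, block_smul, block_unit, tail_sub, tail_smul, tail_blockUnit, smul_zero,
      sub_zero, Pi.sub_apply, Pi.smul_apply, blockUnit_zero, smul_eq_mul] at hmem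
    linarith
  · intro hv
    have hopen : IsOpen {v : Vec d | ∀ i, eucNorm (Fin.tail (block v i)) < block v i 0} := by
      simp only [Set.ofPred_forall]
      refine isOpen_iInter_of_finite fun i => isOpen_lt ?_ ?_
      · refine continuous_norm.comp ((PiLp.continuous_toLp 2 _).comp ?_)
        exact continuous_pi fun j => continuous_apply _
      · exact continuous_apply _
    refine interior_maximal (t := {v : Vec d | ∀ i, eucNorm (Fin.tail (block v i)) < block v i 0})
      (fun w hw i => (hw i).le) hopen ?_
    exact fun i => (inCone_iff _).1 (hv i)

end Blocks

/-- The ball of radius `t/√2` about `t e` is interior: there the Lorentz form exceeds `(t + 2 q₁)² /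
2`. -/
theorem inCone_of_near_unit {m : ℕ} {t : ℝ} {q : Fin (m + 1) → ℝ} (ht : 0 < t)
    (hq : 2 * (q ⬝ᵥ q) < t ^ 2) : InCone (t • blockUnit m + q) := by
  have h2 := dotProduct_self_nonneg' (Fin.tail q)
  rw [dot_eq] at hq
  have hpos : 0 < t + q 0 := by
    have : q 0 ^ 2 < t ^ 2 := by nlinarith [sq_nonneg (q 0)]
    linarith [(abs_lt.1 (abs_lt_of_sq_lt_sq this ht.le)).1]
  refine ⟨by simpa [blockUnit_zero] using hpos, ?_⟩
  rw [lorentzSq, tail_add, tail_smul, tail_blockUnit, smul_zero, zero_add]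
  simp only [Pi.add_apply, Pi.smul_apply, blockUnit_zero, smul_eq_mul, mul_one]
  nlinarith [sq_nonneg (t + 2 * q 0)]

/-! ### Orthogonal directions in a Hilbert space. -/

section Estimate

variable {H : Type*} [NormedAddCommGroup H] [InnerProductSpace ℝ H]

/-- The size of orthogonal directions `u`, `v` when `v + μ u` is small up to a relative error. -/
theorem direction_estimate {u v q g f : H} {γ μ h : ℝ} (hγ : 0 < γ) (hγ' : γ < 1 / 3)
    (hμ : 0 < μ) (horth : inner ℝ u v = 0) (heq : v + μ • u = q - g + f)
    (hq : ‖q‖ ≤ μ * h) (hg : ‖g‖ ≤ γ * μ * ‖u‖) (hf : ‖f‖ ≤ Real.sqrt 2 * γ * μ * ‖u‖) :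
    ‖u‖ ≤ h / (1 - 3 * γ) ∧ ‖v‖ ≤ μ * (h / (1 - 3 * γ)) ∧
      ‖u‖ * ‖v‖ ≤ μ * (h / (1 - 3 * γ)) ^ 2 / 2 := by
  have hpyth : ‖v + μ • u‖ ^ 2 = ‖v‖ ^ 2 + (μ * ‖u‖) ^ 2 := by
    rw [norm_add_sq_real, inner_smul_right, real_inner_comm, horth, norm_smul, Real.norm_eq_abs,
      abs_of_pos hμ]
    ring
  have hu : μ * ‖u‖ ≤ ‖v + μ • u‖ :=
    le_of_sq_le_sq (by rw [hpyth]; nlinarith [sq_nonneg ‖v‖]) (norm_nonneg _)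
  have hv : ‖v‖ ≤ ‖v + μ • u‖ :=
    le_of_sq_le_sq (by rw [hpyth]; nlinarith [sq_nonneg (μ * ‖u‖)]) (norm_nonneg _)
  set ρ := ‖v + μ • u‖ with hρ
  have hρ0 : 0 ≤ ρ := norm_nonneg _
  have h13 : 0 < 1 - 3 * γ := by linarith
  -- One `γ` comes from `g`, and `√2 γ ≤ 2γ` from `f`; this is where `γ < 1/3` originates.
  have htri : ρ ≤ μ * h + 3 * γ * ρ := by
    have h1 : ρ ≤ ‖q‖ + ‖g‖ + ‖f‖ := by
      rw [hρ, heq]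
      exact (norm_add_le _ _).trans (add_le_add (norm_sub_le _ _) le_rfl)
    have h2 : Real.sqrt 2 ≤ 2 := by
      rw [Real.sqrt_le_left (by norm_num)]; norm_num
    have h3 : ‖g‖ ≤ γ * ρ := hg.trans (by rw [mul_assoc]; gcongr)
    have h4 : ‖f‖ ≤ 2 * γ * ρ := hf.trans (by
      rw [mul_assoc _ μ]
      gcongr)
    linarith
  have hbound : ρ ≤ μ * (h / (1 - 3 * γ)) := by
    rw [← mul_div_assoc, le_div_iff₀ h13]; linarith
  refine ⟨le_of_mul_le_mul_left (hu.trans hbound) hμ, hv.trans hbound, ?_⟩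
  have h5 : μ * ‖u‖ * ‖v‖ ≤ ρ ^ 2 / 2 := by nlinarith [sq_nonneg (μ * ‖u‖ - ‖v‖)]
  have h6 : ρ ^ 2 ≤ (μ * (h / (1 - 3 * γ))) ^ 2 := by gcongr
  refine le_of_mul_le_mul_left ?_ hμ
  nlinarith

end Estimate

/-! ### Size of the directions and invariance of the distance. -/

section Step

variable {k : ℕ} {d : Fin k → ℕ}

theorem mat_mulVec_comm (a b : Vec d) : mat a *ᵥ b = mat b *ᵥ a := by
  refine ext_block fun i => ?_
  rw [block_mat_mulVec, block_mat_mulVec, arrow_mulVec_eq, arrow_mulVec_eq, dotProduct_comm,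
    mul_comm (block a i 0)]
  abel

theorem mat_sub_mulVec (a b c : Vec d) : mat (a - b) *ᵥ c = mat a *ᵥ c - mat b *ᵥ c := by
  rw [mat_mulVec_comm, Matrix.mulVec_sub, mat_mulVec_comm c a, mat_mulVec_comm c b]

theorem mat_add_mulVec (a b c : Vec d) : mat (a + b) *ᵥ c = mat a *ᵥ c + mat b *ᵥ c := by
  rw [mat_mulVec_comm, Matrix.mulVec_add, mat_mulVec_comm c a, mat_mulVec_comm c b]

theorem mat_smul_unit_mulVec (r : ℝ) (a : Vec d) : mat (r • unit d) *ᵥ a = r • a := by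
  rw [mat_mulVec_comm, Matrix.mulVec_smul, mat_mulVec_unit]

theorem norm_aug_sub_le {x s : Vec d} {κ τ μ γ : ℝ}
    (hnb : Real.sqrt 2 * ‖aug (tMat x *ᵥ s - μ • unit d) (κ * τ - μ)‖ ≤ γ * μ) :
    2 * ‖aug (tMat x *ᵥ s - μ • unit d) (κ * τ - μ)‖ ^ 2 ≤ (γ * μ) ^ 2 := by
  have h := pow_le_pow_left₀ (by positivity) hnb 2
  rwa [mul_pow, Real.sq_sqrt (by norm_num)] at h

/-- Size of the solutions of the scaled complementarity equations in the frame of `x`. -/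
theorem hat_direction_estimate {x s a σ : Vec d} {κ τ dκ dτ μ γ c ξ h : ℝ}
    {D : Matrix (Idx d) (Idx d) ℝ}
    (hγ : 0 < γ) (hγ' : γ < 1 / 3) (hμ : 0 < μ) (hτ : 0 < τ)
    (hx : ∀ i, InCone (block x i)) (hD : D ∈ scalings d)
    (hnb : Real.sqrt 2 * ‖aug (tMat x *ᵥ s - μ • unit d) (κ * τ - μ)‖ ≤ γ * μ)
    (hm : mat ((D⁻¹)ᵀ *ᵥ x) *ᵥ (D *ᵥ (σ + c • s)) + mat (D *ᵥ s) *ᵥ ((D⁻¹)ᵀ *ᵥ a)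
      = ξ • unit d)
    (hs : κ * dτ + τ * (dκ + c * κ) = ξ) (horth : a ⬝ᵥ σ + dκ * dτ = 0)
    (hq : ‖aug (ξ • unit d - c • (tMat x *ᵥ s)) (ξ - c * (κ * τ))‖ ≤ μ * h) :
    ‖aug (tMat x *ᵥ (σ + c • s) + mat (tMat x *ᵥ s) *ᵥ hatX x a - ξ • unit d) 0‖
        ≤ Real.sqrt 2 * γ * μ * ‖aug (hatX x a) (dτ / τ)‖ ∧
      ‖aug (hatX x a) (dτ / τ)‖ ≤ h / (1 - 3 * γ) ∧
      ‖aug (tMat x *ᵥ σ) (τ * dκ)‖ ≤ μ * (h / (1 - 3 * γ)) ∧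
      ‖aug (hatX x a) (dτ / τ)‖ * ‖aug (tMat x *ᵥ σ) (τ * dκ)‖
        ≤ μ * (h / (1 - 3 * γ)) ^ 2 / 2 := by
  have hE := norm_aug_sub_le hnb
  have hf : ‖aug (tMat x *ᵥ (σ + c • s) + mat (tMat x *ᵥ s) *ᵥ hatX x a - ξ • unit d) 0‖
      ≤ Real.sqrt 2 * γ * μ * ‖aug (hatX x a) (dτ / τ)‖ := by
    refine norm_aug_le (by positivity) (fun i => ?_) ?_
    swap
    · rw [zero_pow two_ne_zero]; positivity
    obtain ⟨n, hn, h0, ht⟩ := hat_equation hx hD hm i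
    rw [dot_eq, block_sub, tail_sub, ht, block_smul, block_unit, tail_smul, tail_blockUnit,
      smul_zero, sub_zero]
    have hz : (block (tMat x *ᵥ (σ + c • s) + mat (tMat x *ᵥ s) *ᵥ hatX x a) i
        - ξ • blockUnit (d i)) 0 = 0 := by
      rw [Pi.sub_apply, Pi.smul_apply, blockUnit_zero, block_add, Pi.add_apply, block_tMat_mulVec,
        tBlock_mulVec_zero, block_mat_mulVec, arrow_mulVec_zero, block_tMat_mulVec, block_hatX,
        dotProduct_comm (tBlock _ *ᵥ _), dot_tBlock_tInv (hx i), dotProduct_comm (block a i), h0]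
      simp
    rw [hz, mul_zero, zero_add]
    refine (skew_norm_bound hn).trans ?_
    -- Subtracting `μ e` does not touch tails, so the tail of `T_x s` is as small as the
    -- neighborhood allows.
    have hw : Fin.tail (block (tMat x *ᵥ s) i)
        = Fin.tail (block (tMat x *ᵥ s - μ • unit d) i) := by
      rw [block_sub, block_smul, block_unit, tail_sub, tail_smul, tail_blockUnit]; simp
    have h1 := block_dot_le_norm_aug (tMat x *ᵥ s - μ • unit d) (κ * τ - μ) i
    have h2 := dot_eq (block (hatX x a) i) (block (hatX x a) i)
    rw [dot_eq, ← hw] at h1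
    have h3 := dotProduct_self_nonneg' (Fin.tail (block (hatX x a) i))
    have h4 : (Real.sqrt 2 * γ * μ) ^ 2 = 2 * (γ * μ) ^ 2 := by
      rw [mul_assoc, mul_pow, Real.sq_sqrt (by norm_num)]
    rw [h4]
    refine mul_le_mul ?_ ?_ h3 (by positivity)
    · nlinarith [mul_self_nonneg (block (tMat x *ᵥ s - μ • unit d) i 0)]
    · rw [h2]; nlinarith [mul_self_nonneg (block (hatX x a) i 0)]
  have hu : inner ℝ (aug (hatX x a) (dτ / τ)) (aug (tMat x *ᵥ σ) (τ * dκ)) = 0 := by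
    rw [inner_aug, ← horth, dot_blocks, dot_blocks]
    congr 1
    · refine Finset.sum_congr rfl fun i _ => ?_
      rw [block_hatX, block_tMat_mulVec, dot_tBlock_tInv (hx i)]
    · field_simp
  -- Replacing `w` by `μ e` in the product with `u` costs the second term, and the skew error is the
  -- third; the scalar equation, divided suitably by `τ`, is exact.
  have heq : aug (tMat x *ᵥ σ) (τ * dκ) + μ • aug (hatX x a) (dτ / τ)
      = aug (ξ • unit d - c • (tMat x *ᵥ s)) (ξ - c * (κ * τ))
        - aug (mat (tMat x *ᵥ s - μ • unit d) *ᵥ hatX x a) ((κ * τ - μ) * (dτ / τ))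
        + aug (tMat x *ᵥ (σ + c • s) + mat (tMat x *ᵥ s) *ᵥ hatX x a - ξ • unit d) 0 := by
    rw [← aug_smul, ← aug_add, ← aug_sub, ← aug_add, mat_sub_mulVec, mat_smul_unit_mulVec,
      Matrix.mulVec_add, Matrix.mulVec_smul]
    congr 1
    · abel
    · rw [← hs]; field_simp; ring
  have hg : ‖aug (mat (tMat x *ᵥ s - μ • unit d) *ᵥ hatX x a) ((κ * τ - μ) * (dτ / τ))‖
      ≤ γ * μ * ‖aug (hatX x a) (dτ / τ)‖ :=
    (norm_aug_mat_mulVec_le _ _ _ _).trans (by gcongr)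
  exact ⟨hf, direction_estimate hγ hγ' hμ hu heq hq hg hf⟩

/-- The distance involves only the inner product and the product of the two Lorentz forms, and both
are unchanged when `T_u` acts on one argument and its inverse on the other. -/
theorem block_distance_le {m : ℕ} {u p q : Fin (m + 1) → ℝ} (hu : InCone u) (hp : InCone p)
    (t : ℝ) :
    (tBlock (tBlock u *ᵥ p) *ᵥ (tInv u *ᵥ q) - t • blockUnit m)
        ⬝ᵥ (tBlock (tBlock u *ᵥ p) *ᵥ (tInv u *ᵥ q) - t • blockUnit m)
      ≤ (arrow p *ᵥ q - t • blockUnit m) ⬝ᵥ (arrow p *ᵥ q - t • blockUnit m) := by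
  have h1 : lorentzSq u * lorentzSq (tInv u *ᵥ q) = lorentzSq q := by
    rw [← lorentzSq_tBlock hu, Matrix.mulVec_mulVec, tBlock_mul_tInv hu, Matrix.one_mulVec]
  have h2 : lorentzSq u * lorentzSq p * lorentzSq (tInv u *ᵥ q) = lorentzSq p * lorentzSq q := by
    rw [← h1]; ring
  have h3 : (tBlock u *ᵥ p) ⬝ᵥ (tInv u *ᵥ q) = p ⬝ᵥ q := by
    rw [dotProduct_comm, dot_tBlock_tInv hu, dotProduct_comm]
  rw [dot_self_tBlock_sub (hu.tBlock_mulVec hp), lorentzSq_tBlock hu, h2, h3]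
  exact arrow_sub_bound p q t

end Step

/-! ### The self-dual model: exact identities along a step and solvability of the system. -/

section Model

variable {k : ℕ} {d : Fin k → ℕ} {p : ℕ}

theorem mem_nbhd2 {γ : ℝ} {z : Point d p} : z ∈ nbhd2 d p γ ↔
    (∀ i, InCone (block z.x i)) ∧ (∀ i, InCone (block z.s i)) ∧ 0 < z.κ ∧ 0 < z.τ ∧
      Real.sqrt 2 * ‖aug (tMat z.x *ᵥ z.s - mu z • unit d) (z.κ * z.τ - mu z)‖ ≤ γ * mu z := by
  change (z.x ∈ interior (cone d) ∧ z.s ∈ interior (cone d) ∧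
    z.κ ∈ interior (Set.Ici (0 : ℝ)) ∧ z.τ ∈ interior (Set.Ici (0 : ℝ))) ∧ _ ↔ _
  rw [mem_interior_cone, mem_interior_cone, interior_Ici, Set.mem_Ioi, Set.mem_Ioi, and_assoc,
    and_assoc, and_assoc]
  rfl

theorem mu_mul (z : Point d p) : ((k : ℝ) + 1) * mu z = z.x ⬝ᵥ z.s + z.κ * z.τ := by
  rw [mu, mul_div_cancel₀]
  positivity

theorem mu_pos {γ : ℝ} {z : Point d p} (hz : z ∈ nbhd2 d p γ) : 0 < mu z := by
  obtain ⟨hx, hs, hκ, hτ, -⟩ := mem_nbhd2.1 hz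
  rw [mu, dot_blocks]
  have := Finset.sum_nonneg (s := Finset.univ) (f := fun i => block z.x i ⬝ᵥ block z.s i)
    (fun i _ => ((hx i).dot_pos (hs i)).le)
  positivity

theorem dot_unit_unit : unit d ⬝ᵥ unit d = k := by
  rw [dot_blocks]
  simp [block_unit, dot_eq, blockUnit_zero, tail_blockUnit]

theorem dot_unit_tMat (x s : Vec d) : unit d ⬝ᵥ (tMat x *ᵥ s) = x ⬝ᵥ s := by
  rw [dot_blocks, dot_blocks]
  refine Finset.sum_congr rfl fun i _ => ?_
  rw [block_unit, dot_eq, blockUnit_zero, tail_blockUnit, block_tMat_mulVec, tBlock_mulVec_zero]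
  simp

/-- Solutions of the homogeneous self-dual equations are orthogonal. -/
theorem self_dual_orthogonal {A : Matrix (Fin p) (Idx d) ℝ} {b : Fin p → ℝ} {c : Vec d}
    {x s : Vec d} {y : Fin p → ℝ} {κ τ : ℝ} (h1 : A *ᵥ x - τ • b = 0)
    (h2 : -(Aᵀ *ᵥ y) + τ • c - s = 0) (h3 : b ⬝ᵥ y - c ⬝ᵥ x - κ = 0) :
    x ⬝ᵥ s + κ * τ = 0 := by
  have hs : s = -(Aᵀ *ᵥ y) + τ • c := (sub_eq_zero.1 h2).symm
  have hx : x ⬝ᵥ (Aᵀ *ᵥ y) = τ * (b ⬝ᵥ y) := by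
    rw [Matrix.mulVec_transpose, dotProduct_comm, ← Matrix.dotProduct_mulVec, sub_eq_zero.1 h1,
      dotProduct_smul, smul_eq_mul, dotProduct_comm]
  rw [hs, dotProduct_add, dotProduct_neg, hx, dotProduct_smul, smul_eq_mul, dotProduct_comm x c]
  linear_combination -τ * h3

variable {A : Matrix (Fin p) (Idx d) ℝ} {b : Fin p → ℝ} {c : Vec d} {ν γ : ℝ}
  {D : Matrix (Idx d) (Idx d) ℝ} {z Δ : Point d p}

/-- Since `mat(s̄) e = s̄`, the right-hand side product can be absorbed into the unknown `Δs + s`.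
-/
theorem IsDirection.complementarity (h : IsDirection A b c ν D z Δ) :
    mat ((D⁻¹)ᵀ *ᵥ z.x) *ᵥ (D *ᵥ (Δ.s + (1 : ℝ) • z.s)) + mat (D *ᵥ z.s) *ᵥ ((D⁻¹)ᵀ *ᵥ Δ.x)
      = (ν * mu z) • unit d := by
  have h4 := h.2.2.2.1
  rw [mat_mulVec_unit] at h4
  rw [one_smul, Matrix.mulVec_add, Matrix.mulVec_add, add_right_comm, h4, sub_add_cancel]

theorem IsDirection.cross_sum (h : IsDirection A b c ν D z Δ)
    (hx : ∀ i, InCone (block z.x i)) (hD : D ∈ scalings d) :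
    z.x ⬝ᵥ Δ.s + z.s ⬝ᵥ Δ.x + z.κ * Δ.τ + z.τ * Δ.κ = -(1 - ν) * (((k : ℝ) + 1) * mu z) := by
  have h1 : z.x ⬝ᵥ (Δ.s + (1 : ℝ) • z.s) + z.s ⬝ᵥ Δ.x = k * (ν * mu z) := by
    rw [dot_blocks, dot_blocks, ← Finset.sum_add_distrib]
    rw [Finset.sum_congr rfl fun i _ => ?_]
    · rw [Finset.sum_const, Finset.card_univ, Fintype.card_fin, nsmul_eq_mul]
    · obtain ⟨_, _, h0, _⟩ := hat_equation hx hD h.complementarity i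
      exact h0
  have h5 := h.2.2.2.2
  have hmu := mu_mul z
  rw [one_smul, dotProduct_add] at h1
  linear_combination h1 + h5 + hmu

theorem IsDirection.orthogonal (h : IsDirection A b c ν D z Δ)
    (hx : ∀ i, InCone (block z.x i)) (hD : D ∈ scalings d) :
    Δ.x ⬝ᵥ Δ.s + Δ.κ * Δ.τ = 0 := by
  have hc := h.cross_sum hx hD
  obtain ⟨h1, h2, h3, -, -⟩ := h
  -- The shifted tuple `Δ + (1 - ν) z` solves the homogeneous equations; the cross terms of its
  -- vanishing product are known from `IsDirection.cross_sum`.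
  have ho := self_dual_orthogonal (A := A) (b := b) (c := c) (x := Δ.x + (1 - ν) • z.x)
    (y := Δ.y + (1 - ν) • z.y) (s := Δ.s + (1 - ν) • z.s) (κ := Δ.κ + (1 - ν) * z.κ)
    (τ := Δ.τ + (1 - ν) * z.τ)
    (by
      rw [← sub_eq_zero] at h1
      rw [← h1, Matrix.mulVec_add, Matrix.mulVec_smul]
      module)
    (by
      rw [← sub_eq_zero] at h2
      rw [← h2, Matrix.mulVec_add, Matrix.mulVec_smul]
      module)
    (by
      rw [dotProduct_add, dotProduct_add, dotProduct_smul, dotProduct_smul, smul_eq_mul,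
        smul_eq_mul]
      linear_combination h3)
  have hmu := mu_mul z
  simp only [dotProduct_add, add_dotProduct, dotProduct_smul, smul_dotProduct, smul_eq_mul,
    dotProduct_comm Δ.x z.s] at ho
  linear_combination ho - (1 - ν) * hc + (1 - ν) ^ 2 * hmu

theorem IsDirection.mu_add (h : IsDirection A b c ν D z Δ)
    (hx : ∀ i, InCone (block z.x i)) (hD : D ∈ scalings d) : mu (z + Δ) = ν * mu z := by
  have hk : ((k : ℝ) + 1) ≠ 0 := by positivity
  apply mul_left_cancel₀ hk
  rw [mu_mul]
  change (z.x + Δ.x) ⬝ᵥ (z.s + Δ.s) + (z.κ + Δ.κ) * (z.τ + Δ.τ) = _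
  have h1 := h.cross_sum hx hD
  have h2 := h.orthogonal hx hD
  have hmu := mu_mul z
  simp only [dotProduct_add, add_dotProduct, dotProduct_comm Δ.x z.s]
  linear_combination h1 + h2 - hmu

theorem IsDirection.resP_add (h : IsDirection A b c ν D z Δ) :
    resP A b (z + Δ) = ν • resP A b z := by
  have h1 := h.1
  rw [← sub_eq_zero] at h1 ⊢
  change A *ᵥ (z.x + Δ.x) - (z.τ + Δ.τ) • b - ν • (A *ᵥ z.x - z.τ • b) = 0
  rw [← h1, Matrix.mulVec_add]
  module

theorem IsDirection.resD_add (h : IsDirection A b c ν D z Δ) :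
    resD A c (z + Δ) = ν • resD A c z := by
  have h2 := h.2.1
  rw [eq_comm, ← sub_eq_zero] at h2
  rw [← sub_eq_zero]
  change Aᵀ *ᵥ (z.y + Δ.y) + (z.s + Δ.s) - (z.τ + Δ.τ) • c
    - ν • (Aᵀ *ᵥ z.y + z.s - z.τ • c) = 0
  rw [← h2, Matrix.mulVec_add]
  module

/-- The linear operator of the Newton system. -/
def newtonMap (A : Matrix (Fin p) (Idx d) ℝ) (b : Fin p → ℝ) (c : Vec d)
    (D : Matrix (Idx d) (Idx d) ℝ) (z : Point d p) :
    (Vec d × (Fin p → ℝ) × Vec d × ℝ × ℝ) →ₗ[ℝ] ((Fin p → ℝ) × Vec d × ℝ × Vec d × ℝ) where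
  toFun v := (A *ᵥ v.1 - v.2.2.2.2 • b, -(Aᵀ *ᵥ v.2.1) + v.2.2.2.2 • c - v.2.2.1,
    b ⬝ᵥ v.2.1 - c ⬝ᵥ v.1 - v.2.2.2.1,
    mat ((D⁻¹)ᵀ *ᵥ z.x) *ᵥ (D *ᵥ v.2.2.1) + mat (D *ᵥ z.s) *ᵥ ((D⁻¹)ᵀ *ᵥ v.1),
    z.κ * v.2.2.2.2 + z.τ * v.2.2.2.1)
  map_add' v w := by
    simp only [Prod.fst_add, Prod.snd_add, Matrix.mulVec_add, dotProduct_add, Prod.mk_add_mk,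
      Prod.mk.injEq]
    refine ⟨by module, by module, by ring, by abel, by ring⟩
  map_smul' r v := by
    simp only [Prod.smul_fst, Prod.smul_snd, Matrix.mulVec_smul, dotProduct_smul, Prod.smul_mk,
      Prod.mk.injEq, smul_eq_mul, RingHom.id_apply]
    refine ⟨by module, by module, by ring, by module, by ring⟩

theorem transpose_mulVec_injective_of_rank {ι : Type*} [Fintype ι] [DecidableEq ι]
    {A : Matrix (Fin p) ι ℝ} (hA : A.rank = p) {y : Fin p → ℝ} (hy : Aᵀ *ᵥ y = 0) : y = 0 := by
  have h1 : Module.finrank ℝ (LinearMap.range Aᵀ.mulVecLin) = p :=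
    (Matrix.rank_transpose A).trans hA
  have h2 := LinearMap.finrank_range_add_finrank_ker Aᵀ.mulVecLin
  rw [h1, Module.finrank_fin_fun] at h2
  have h3 : LinearMap.ker Aᵀ.mulVecLin = ⊥ := Submodule.finrank_eq_zero.1 (by omega)
  have h4 : y ∈ LinearMap.ker Aᵀ.mulVecLin := LinearMap.mem_ker.2 hy
  rwa [h3, Submodule.mem_bot] at h4

/-- A kernel element satisfies the size estimate with zero right-hand side, so all components but
`y` vanish; then `Aᵀ y = 0` and the rank condition finishes. -/
theorem newtonMap_injective (hγ : 0 < γ) (hγ' : γ < 1 / 3) (hA : A.rank = p)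
    (hz : z ∈ nbhd2 d p γ) (hD : D ∈ scalings d) :
    Function.Injective (newtonMap A b c D z) := by
  rw [injective_iff_map_eq_zero]
  rintro ⟨x, y, s, κ, τ⟩ h
  simp only [newtonMap, LinearMap.coe_mk, AddHom.coe_mk, Prod.mk_eq_zero] at h
  obtain ⟨h1, h2, h3, h4, h5⟩ := h
  have hμ := mu_pos hz
  obtain ⟨hx, hs, hκ, hτ, hnb⟩ := mem_nbhd2.1 hz
  obtain ⟨-, hu, hv, -⟩ := hat_direction_estimate (s := z.s) (a := x) (σ := s) (κ := z.κ)
    (τ := z.τ) (dκ := κ) (dτ := τ) (c := 0) (ξ := 0) (h := 0) hγ hγ' hμ hτ hx hD hnb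
    (by simpa using h4) (by simpa using h5) (self_dual_orthogonal h1 h2 h3)
    (by simp [aug_zero])
  rw [zero_div] at hu
  rw [zero_div, mul_zero] at hv
  have key : ∀ {a : Vec d} {t : ℝ}, ‖aug a t‖ ≤ 0 → a = 0 ∧ t = 0 := by
    intro a t h
    have h' := (WithLp.toLp_eq_zero 2).1 (norm_le_zero_iff.1 h)
    exact ⟨funext fun q => congrFun h' (Sum.inl q), congrFun h' (Sum.inr ())⟩
  obtain ⟨hx0, hτ0⟩ := key hu
  obtain ⟨hs0, hκ0⟩ := key hv
  have ex : x = 0 := ext_block fun i => by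
    have := congrArg (fun v => tBlock (block z.x i) *ᵥ block v i) hx0
    simp only [block_hatX, Matrix.mulVec_mulVec, tBlock_mul_tInv (hx i), Matrix.one_mulVec] at this
    rw [this]; exact Matrix.mulVec_zero _
  have es : s = 0 := ext_block fun i => by
    have := congrArg (fun v => tInv (block z.x i) *ᵥ block v i) hs0
    simp only [block_tMat_mulVec, Matrix.mulVec_mulVec, tInv_mul_tBlock (hx i),
      Matrix.one_mulVec] at this
    rw [this]; exact Matrix.mulVec_zero _
  have eτ : τ = 0 := by simpa [hτ.ne'] using hτ0
  have eκ : κ = 0 := by simpa [hτ.ne'] using hκ0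
  have ey : y = 0 := transpose_mulVec_injective_of_rank hA (by simpa [es, eτ] using h2)
  rw [ex, es, eτ, eκ, ey]; rfl

theorem existsUnique_isDirection (hγ : 0 < γ) (hγ' : γ < 1 / 3) (hA : A.rank = p)
    (hz : z ∈ nbhd2 d p γ) (hD : D ∈ scalings d) : ∃! Δ, IsDirection A b c ν D z Δ := by
  have hinj := newtonMap_injective (b := b) (c := c) hγ hγ' hA hz hD
  have hfin : Module.finrank ℝ (Vec d × (Fin p → ℝ) × Vec d × ℝ × ℝ)
      = Module.finrank ℝ ((Fin p → ℝ) × Vec d × ℝ × Vec d × ℝ) := by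
    simp only [Module.finrank_prod]; ring
  have hsurj := (LinearMap.injective_iff_surjective_of_finrank_eq_finrank hfin).1 hinj
  obtain ⟨⟨x, y, s, κ, τ⟩, hv⟩ := hsurj (-((1 - ν) • (A *ᵥ z.x - z.τ • b)),
    -((1 - ν) • (-(Aᵀ *ᵥ z.y) + z.τ • c - z.s)), -((1 - ν) * (b ⬝ᵥ z.y - c ⬝ᵥ z.x - z.κ)),
    (ν * mu z) • unit d - mat ((D⁻¹)ᵀ *ᵥ z.x) *ᵥ (mat (D *ᵥ z.s) *ᵥ unit d),
    ν * mu z - z.κ * z.τ)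
  refine ⟨⟨x, y, s, κ, τ⟩, ?_, fun Δ hΔ => ?_⟩
  · simpa only [IsDirection, newtonMap, LinearMap.coe_mk, AddHom.coe_mk, Prod.mk.injEq] using hv
  · have h : newtonMap A b c D z (Δ.x, Δ.y, Δ.s, Δ.κ, Δ.τ)
        = newtonMap A b c D z (x, y, s, κ, τ) := by
      rw [hv]
      simpa only [IsDirection, newtonMap, LinearMap.coe_mk, AddHom.coe_mk, Prod.mk.injEq] using hΔ
    have := hinj h
    simp only [Prod.mk.injEq] at this
    exact Point.ext this.1 this.2.1 this.2.2.1 this.2.2.2.1 this.2.2.2.2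

end Model

/-! ### One full step, the whole run and the iteration bound. -/

section Iteration

variable {k : ℕ} {d : Fin k → ℕ} {p : ℕ} {A : Matrix (Fin p) (Idx d) ℝ} {b : Fin p → ℝ}
  {c : Vec d}

theorem nuFactor_mem (k : ℕ) {δ : ℝ} (hδ : δ ∈ Set.Ioo (0 : ℝ) 1) :
    nuFactor k δ ∈ Set.Ioo (0 : ℝ) 1 := by
  have h1 : (1 : ℝ) < Real.sqrt (2 * ((k : ℝ) + 1)) := by
    rw [Real.lt_sqrt (by norm_num)]
    have : (0 : ℝ) ≤ k := Nat.cast_nonneg k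
    linarith
  have h2 : δ / Real.sqrt (2 * ((k : ℝ) + 1)) < 1 := by
    rw [div_lt_one (by linarith)]; linarith [hδ.2]
  have h3 : 0 < δ / Real.sqrt (2 * ((k : ℝ) + 1)) := div_pos hδ.1 (by linarith)
  exact ⟨by unfold nuFactor; linarith, by unfold nuFactor; linarith⟩

theorem one_sub_nuFactor_sq (k : ℕ) (δ : ℝ) :
    (1 - nuFactor k δ) ^ 2 * ((k : ℝ) + 1) = δ ^ 2 / 2 := by
  have h : (0 : ℝ) < 2 * ((k : ℝ) + 1) := by positivity
  rw [nuFactor, sub_sub_cancel, div_pow, Real.sq_sqrt h.le]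
  field_simp

/-- The squared norm of the right-hand side of the centering equation in the frame of `x`. -/
theorem norm_centering_sq (z : Point d p) (ν : ℝ) :
    ‖aug ((ν * mu z) • unit d - (1 : ℝ) • (tMat z.x *ᵥ z.s)) (ν * mu z - 1 * (z.κ * z.τ))‖ ^ 2
      = (1 - ν) ^ 2 * ((k : ℝ) + 1) * mu z ^ 2
        + ‖aug (tMat z.x *ᵥ z.s - mu z • unit d) (z.κ * z.τ - mu z)‖ ^ 2 := by
  -- Pythagoras in disguise: `(w, κτ) - μ (e, 1)` is orthogonal to `(e, 1)`, whose squared norm is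
  -- `k + 1`.
  have hμ := mu_mul z
  have h : ∀ (r : ℝ), ‖aug (tMat z.x *ᵥ z.s - r • unit d) (z.κ * z.τ - r)‖ ^ 2
      = (tMat z.x *ᵥ z.s) ⬝ᵥ (tMat z.x *ᵥ z.s) + (z.κ * z.τ) ^ 2
        - 2 * r * (((k : ℝ) + 1) * mu z) + r ^ 2 * ((k : ℝ) + 1) := by
    intro r
    rw [← real_inner_self_eq_norm_sq, inner_aug, hμ]
    simp only [dotProduct_sub, sub_dotProduct, dotProduct_smul, smul_dotProduct, smul_eq_mul,
      dotProduct_comm (tMat z.x *ᵥ z.s) (unit d), dot_unit_tMat, dot_unit_unit]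
    ring
  have hneg : aug ((ν * mu z) • unit d - (1 : ℝ) • (tMat z.x *ᵥ z.s))
      (ν * mu z - 1 * (z.κ * z.τ))
      = -aug (tMat z.x *ᵥ z.s - (ν * mu z) • unit d) (z.κ * z.τ - ν * mu z) := by
    rw [one_smul, one_mul, aug_sub, aug_sub, neg_sub]
  rw [hneg, norm_neg, h, h]
  ring

/-- With `R = η / (1 - 3γ)` bounding the relative size of the directions, `8 R²` is exactly the left
side of the hypothesis. The other bounds follow from `γν < 1/3` and `η ≤ R`. -/
theorem radius_bounds {γ δ ν η : ℝ} (hγ : γ ∈ Set.Ioo (0 : ℝ) (1 / 3)) (hν0 : 0 < ν)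
    (hν1 : ν ≤ 1) (h13 : 0 < 1 - 3 * γ) (hη0 : 0 ≤ η) (hη2 : η ^ 2 = (γ ^ 2 + δ ^ 2) / 2)
    (hcond : 4 * (γ ^ 2 + δ ^ 2) / (1 - 3 * γ) ^ 2 < γ * ν) :
    8 * (η / (1 - 3 * γ)) ^ 2 < γ * ν ∧ γ ^ 2 ≤ 2 * (η / (1 - 3 * γ)) ^ 2 ∧
      2 * (η / (1 - 3 * γ)) ^ 2 < 1 ∧ (γ + Real.sqrt 2 * (η / (1 - 3 * γ))) ^ 2 < 1 := by
  set R := η / (1 - 3 * γ) with hR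
  have hR0 : 0 ≤ R := div_nonneg hη0 h13.le
  have hR2 : 8 * R ^ 2 < γ * ν := by
    have h1 : 8 * R ^ 2 = 4 * (γ ^ 2 + δ ^ 2) / (1 - 3 * γ) ^ 2 := by
      rw [hR, div_pow, hη2]; ring
    rw [h1]
    exact hcond
  have hγν : γ * ν < 1 / 3 := (mul_le_of_le_one_right hγ.1.le hν1).trans_lt hγ.2
  have hγR : γ ^ 2 ≤ 2 * R ^ 2 := by
    have h1 : η ≤ R := by
      rw [hR, le_div_iff₀ h13]; nlinarith [hγ.1]
    have h2 : η ^ 2 ≤ R ^ 2 := by gcongr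
    nlinarith [sq_nonneg δ]
  refine ⟨hR2, hγR, by linarith, ?_⟩
  have h1 : (Real.sqrt 2 * R) ^ 2 = 2 * R ^ 2 := by
    rw [mul_pow, Real.sq_sqrt (by norm_num)]
  have h2 : Real.sqrt 2 * R < 1 / 3 := lt_of_pow_lt_pow_left₀ 2 (by norm_num) (by
    rw [h1]; linarith)
  have h3 : 0 ≤ Real.sqrt 2 * R := by positivity
  exact pow_lt_one₀ (by linarith [hγ.1]) (by linarith [hγ.2]) two_ne_zero

/-- A full step stays in the neighborhood. -/
theorem IsDirection.add_mem_nbhd2 {γ δ : ℝ} {D : Matrix (Idx d) (Idx d) ℝ} {z Δ : Point d p}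
    (hγ : γ ∈ Set.Ioo (0 : ℝ) (1 / 3)) (hδ : δ ∈ Set.Ioo (0 : ℝ) 1)
    (hcond : 4 * (γ ^ 2 + δ ^ 2) / (1 - 3 * γ) ^ 2 * (nuFactor k δ)⁻¹ < γ)
    (hz : z ∈ nbhd2 d p γ) (hD : D ∈ scalings d)
    (h : IsDirection A b c (nuFactor k δ) D z Δ) : z + Δ ∈ nbhd2 d p γ := by
  have hνp := nuFactor_mem k hδ
  have hν2 := one_sub_nuFactor_sq k δ
  set ν := nuFactor k δ with hν
  have hμ := mu_pos hz
  obtain ⟨hx, hs, hκ, hτ, hnb⟩ := mem_nbhd2.1 hz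
  have hmu := h.mu_add hx hD
  have horth := h.orthogonal hx hD
  have hE := norm_aug_sub_le hnb
  have hcent := norm_centering_sq z ν
  have hm := h.complementarity
  have hs5 := h.2.2.2.2
  set μ := mu z with hμdef
  set w := tMat z.x *ᵥ z.s with hw
  set E := aug (w - μ • unit d) (z.κ * z.τ - μ) with hEdef
  -- The centering term has squared norm at most `μ² η²`: the part `δ²/2` comes from the choice of
  -- `ν`, the part `γ²/2` from the neighborhood.
  set η := Real.sqrt ((γ ^ 2 + δ ^ 2) / 2) with hη
  have hη2 : η ^ 2 = (γ ^ 2 + δ ^ 2) / 2 := Real.sq_sqrt (by positivity)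
  have hη0 : 0 ≤ η := Real.sqrt_nonneg _
  have h13 : 0 < 1 - 3 * γ := by linarith [hγ.2]
  have hq : ‖aug ((ν * μ) • unit d - (1 : ℝ) • w) (ν * μ - 1 * (z.κ * z.τ))‖ ≤ μ * η := by
    refine le_of_sq_le_sq ?_ (by positivity)
    rw [hcent, hν2, mul_pow, hη2]
    linear_combination hE / 2
  obtain ⟨hf, hu, hv, huv⟩ := hat_direction_estimate (a := Δ.x) (σ := Δ.s) (c := 1)
    (ξ := ν * μ) hγ.1 hγ.2 hμ hτ hx hD hnb hm (by linear_combination hs5) horth hq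
  rw [one_smul, Matrix.mulVec_add, ← hw] at hf
  set u := hatX z.x Δ.x with hudef
  set v := tMat z.x *ᵥ Δ.s with hvdef
  set uτ := Δ.τ / z.τ with huτ
  set vκ := z.τ * Δ.κ with hvκ
  set R := η / (1 - 3 * γ) with hR
  have hR0 : 0 ≤ R := div_nonneg hη0 h13.le
  obtain ⟨hR2, hγR, hR1, hsum⟩ :=
    radius_bounds hγ hνp.1 hνp.2.le h13 hη0 hη2 ((mul_inv_lt_iff₀ hνp.1).1 hcond)
  have hunit_u : ∀ i, InCone (blockUnit (d i) + block u i) := fun i => by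
    rw [← one_smul ℝ (blockUnit (d i))]
    refine inCone_of_near_unit one_pos ?_
    have h1 := block_dot_le_norm_aug u uτ i
    have h2 : ‖aug u uτ‖ ^ 2 ≤ R ^ 2 := by gcongr
    linarith
  have hEv : 2 * ‖E + aug v vκ‖ ^ 2 < μ ^ 2 := by
    have h1 : Real.sqrt 2 * ‖E + aug v vκ‖ ≤ (γ + Real.sqrt 2 * R) * μ := by
      calc _ ≤ Real.sqrt 2 * (‖E‖ + ‖aug v vκ‖) := by gcongr; exact norm_add_le _ _
        _ ≤ γ * μ + Real.sqrt 2 * (μ * R) := by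
          rw [mul_add]; gcongr
        _ = _ := by ring
    have h2 := pow_le_pow_left₀ (by positivity) h1 2
    rw [mul_pow, Real.sq_sqrt (by norm_num), mul_pow] at h2
    have h3 := pow_pos hμ 2
    exact h2.trans_lt (mul_lt_of_lt_one_left h3 hsum)
  rw [hEdef, ← aug_add] at hEv
  have hwv : ∀ i, InCone (block w i + block v i) := fun i => by
    have h1 := block_dot_le_norm_aug (w - μ • unit d + v) (z.κ * z.τ - μ + vκ) i
    have h2 := inCone_of_near_unit (q := block (w - μ • unit d + v) i) hμ (by linarith)
    rw [block_add, block_sub, block_smul, block_unit] at h2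
    convert h2 using 1
    abel
  have hX : ∀ i, block (z + Δ).x i = tBlock (block z.x i) *ᵥ (blockUnit (d i) + block u i) := by
    intro i
    rw [Matrix.mulVec_add, tBlock_mulVec_unit, hudef, block_hatX, Matrix.mulVec_mulVec,
      tBlock_mul_tInv (hx i), Matrix.one_mulVec]
    rfl
  have hS : ∀ i, block (z + Δ).s i = tInv (block z.x i) *ᵥ (block w i + block v i) := by
    intro i
    rw [hw, hvdef, block_tMat_mulVec, block_tMat_mulVec, ← Matrix.mulVec_add,
      Matrix.mulVec_mulVec, tInv_mul_tBlock (hx i), Matrix.one_mulVec]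
    rfl
  have huτ2 : uτ ^ 2 < 1 := by
    have h1 := scalar_sq_le_norm_aug u uτ
    have h2 : ‖aug u uτ‖ ^ 2 ≤ R ^ 2 := by gcongr
    linarith
  have hvκ2 : (z.κ * z.τ - μ + vκ) ^ 2 < μ ^ 2 := by
    have h1 := scalar_sq_le_norm_aug (w - μ • unit d + v) (z.κ * z.τ - μ + vκ)
    linarith [sq_nonneg (z.κ * z.τ - μ + vκ)]
  have hτ' : 0 < (z + Δ).τ := by
    have h1 : (z + Δ).τ = z.τ * (1 + uτ) := by
      change z.τ + Δ.τ = _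
      rw [huτ]; field_simp
    rw [h1]
    have := (abs_lt.1 (abs_lt_of_sq_lt_sq (huτ2.trans_eq (one_pow 2).symm) zero_le_one)).1
    exact mul_pos hτ (by linarith)
  have hκ' : 0 < (z + Δ).κ := by
    have h1 : z.τ * (z + Δ).κ = μ + (z.κ * z.τ - μ + vκ) := by
      change z.τ * (z.κ + Δ.κ) = _
      rw [hvκ]; ring
    have := (abs_lt.1 (abs_lt_of_sq_lt_sq hvκ2 hμ.le)).1
    exact pos_of_mul_pos_right (a := z.τ) (by linarith) hτ.le
  refine mem_nbhd2.2 ⟨fun i => ?_, fun i => ?_, hκ', hτ', ?_⟩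
  · rw [hX]; exact (hx i).tBlock_mulVec (hunit_u i)
  · rw [hS]; exact (hx i).tInv_mulVec (hwv i)
  rw [hmu]
  -- Expanding `(e + u) ∘ (w + v)` leaves the linearization error plus the second-order term; in the
  -- scalar coordinate the linearization is exact.
  have hdist : ‖aug (tMat (z + Δ).x *ᵥ (z + Δ).s - (ν * μ) • unit d)
      ((z + Δ).κ * (z + Δ).τ - ν * μ)‖
      ≤ 1 * ‖aug (v + w + mat w *ᵥ u - (ν * μ) • unit d) 0 + aug (mat u *ᵥ v) (uτ * vκ)‖ := by
    rw [← aug_add]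
    refine norm_aug_le zero_le_one (fun i => ?_) ?_
    · rw [one_pow, one_mul, block_sub, block_smul, block_unit, block_tMat_mulVec, hX, hS]
      refine (block_distance_le (hx i) (hunit_u i) _).trans (le_of_eq ?_)
      have h1 : arrow (blockUnit (d i) + block u i) *ᵥ (block w i + block v i)
          - (ν * μ) • blockUnit (d i)
          = block (v + w + mat w *ᵥ u - (ν * μ) • unit d + mat u *ᵥ v) i := by
        rw [← block_unit, ← block_add, ← block_add, ← block_mat_mulVec, ← block_smul, ← block_sub]
        congr 1
        rw [mat_add_mulVec, ← one_smul ℝ (unit d), mat_smul_unit_mulVec, Matrix.mulVec_add,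
          mat_mulVec_comm u w, one_smul, one_smul]
        abel
      rw [h1]
    · refine le_of_eq ?_
      rw [one_pow, one_mul]
      congr 1
      change (z.κ + Δ.κ) * (z.τ + Δ.τ) - ν * μ = _
      rw [huτ, hvκ, ← sub_eq_zero]
      field_simp
      linear_combination hs5
  have hprod := norm_aug_mat_mulVec_le u v uτ vκ
  have hsq : Real.sqrt 2 * Real.sqrt 2 = 2 := Real.mul_self_sqrt (by norm_num)
  calc _ ≤ Real.sqrt 2 * (Real.sqrt 2 * γ * μ * R + Real.sqrt 2 * (μ * R ^ 2 / 2)) := by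
        gcongr
        refine hdist.trans ?_
        rw [one_mul]
        refine (norm_add_le _ _).trans (add_le_add (hf.trans ?_) (hprod.trans ?_))
        · have := hγ.1
          gcongr
        · rw [mul_assoc]; gcongr
    _ = (2 * γ * R + R ^ 2) * μ := by linear_combination (γ * μ * R + μ * R ^ 2 / 2) * hsq
    _ ≤ 8 * R ^ 2 * μ := by
        gcongr
        -- `2γR + R² ≤ γ² + 2R² ≤ 4R²`, using `γ² ≤ 2R²`.
        linarith [two_mul_le_add_sq γ R, sq_nonneg R]
    _ ≤ γ * ν * μ := by gcongr
    _ = _ := by ring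

/-- The iterates stay in the neighborhood, and residuals and central path coefficient decrease
by the same factor in every iteration. -/
theorem IsRun.iterate {γ δ ε : ℝ} {z₀ : Point d p} {j : ℕ} {z : ℕ → Point d p}
    (hγ : γ ∈ Set.Ioo (0 : ℝ) (1 / 3)) (hδ : δ ∈ Set.Ioo (0 : ℝ) 1)
    (hcond : 4 * (γ ^ 2 + δ ^ 2) / (1 - 3 * γ) ^ 2 * (nuFactor k δ)⁻¹ < γ)
    (hz₀ : z₀ ∈ nbhd2 d p γ) (hrun : IsRun A b c δ ε z₀ j z) {i : ℕ} (hi : i ≤ j) :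
    z i ∈ nbhd2 d p γ ∧ resP A b (z i) = nuFactor k δ ^ i • resP A b z₀ ∧
      resD A c (z i) = nuFactor k δ ^ i • resD A c z₀ ∧
      mu (z i) = nuFactor k δ ^ i * mu z₀ := by
  induction i with
  | zero => simp [hrun.1, hz₀]
  | succ i ih =>
    obtain ⟨hn, hp, hd, hm⟩ := ih (by omega)
    obtain ⟨-, D, hD, Δ, hΔ, hz⟩ := hrun.2 i (by omega)
    rw [hz]
    refine ⟨hΔ.add_mem_nbhd2 hγ hδ hcond hn hD, ?_, ?_, ?_⟩
    · rw [hΔ.resP_add, hp, smul_smul, pow_succ']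
    · rw [hΔ.resD_add, hd, smul_smul, pow_succ']
    · rw [hΔ.mu_add (mem_nbhd2.1 hn).1 hD, hm, pow_succ']; ring

/-- For `k ≥ 1`, `√(2(k + 1)) ≤ 2√k`, hence `-log ν ≥ 1 - ν ≥ δ / (2√k)`; this yields the constant
`2/δ`. -/
theorem nuFactor_pow_le {δ ε : ℝ} (hδ : δ ∈ Set.Ioo (0 : ℝ) 1) (hε : ε ∈ Set.Ioo (0 : ℝ) 1)
    (hk : 0 < k) {i : ℕ} (hi : 2 / δ * Real.sqrt k * Real.log (1 / ε) ≤ i) :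
    nuFactor k δ ^ i ≤ ε := by
  have hν := nuFactor_mem k hδ
  have hk1 : (1 : ℝ) ≤ k := by exact_mod_cast hk
  have hs : Real.sqrt (2 * ((k : ℝ) + 1)) ≤ 2 * Real.sqrt k := by
    rw [Real.sqrt_le_left (by positivity), mul_pow, Real.sq_sqrt (by positivity)]
    linarith
  have hs0 : 0 < Real.sqrt (2 * ((k : ℝ) + 1)) := Real.sqrt_pos.2 (by positivity)
  have hsk : 0 < Real.sqrt k := Real.sqrt_pos.2 (by linarith)
  have h1 : δ / (2 * Real.sqrt k) ≤ 1 - nuFactor k δ := by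
    rw [nuFactor, sub_sub_cancel]
    exact div_le_div_of_nonneg_left hδ.1.le hs0 hs
  have h2 := Real.log_le_sub_one_of_pos hν.1
  rw [← Real.log_le_log_iff (pow_pos hν.1 i) hε.1, Real.log_pow]
  rw [one_div, Real.log_inv] at hi
  have hδ0 := hδ.1
  have h3 : -Real.log ε ≤ i * (δ / (2 * Real.sqrt k)) := by
    have := mul_le_mul_of_nonneg_right hi (by positivity : 0 ≤ δ / (2 * Real.sqrt k))
    refine le_trans (le_of_eq ?_) this
    field_simp
  have h4 : (i : ℝ) * (δ / (2 * Real.sqrt k)) ≤ i * (-Real.log (nuFactor k δ)) := by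
    gcongr
    linarith
  linarith

end Iteration

end SOCP

end

theorem proposition5 (γ δ : ℝ) (hγ : γ ∈ Set.Ioo (0 : ℝ) (1 / 3))
    (hδ : δ ∈ Set.Ioo (0 : ℝ) 1) :
    ∃ C : ℝ, 0 < C ∧
      ∀ (k : ℕ) (_hk : 0 < k)
        (_hcond : 4 * (γ ^ 2 + δ ^ 2) / (1 - 3 * γ) ^ 2
          * (1 - δ / Real.sqrt (2 * ((k : ℝ) + 1)))⁻¹ < γ)
        (d : Fin k → ℕ) (p : ℕ) (A : Matrix (Fin p) (SOCP.Idx d) ℝ) (_hA : A.rank = p)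
        (b : Fin p → ℝ) (c : SOCP.Vec d)
        (z₀ : SOCP.Point d p) (_hz₀ : z₀ ∈ SOCP.nbhd2 d p γ)
        (ε : ℝ) (_hε : ε ∈ Set.Ioo (0 : ℝ) 1)
        (j : ℕ) (z : ℕ → SOCP.Point d p) (_hrun : SOCP.IsRun A b c δ ε z₀ j z),
        -- the search direction is well defined at the current iterate, for every scaling
        (∀ D ∈ SOCP.scalings d,
          ∃! Δ : SOCP.Point d p, SOCP.IsDirection A b c (SOCP.nuFactor k δ) D (z j) Δ) ∧
        -- the iterate after `j` iterations
        z j ∈ SOCP.nbhd2 d p γ ∧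
        SOCP.resP A b (z j)
          = (1 - δ / Real.sqrt (2 * ((k : ℝ) + 1))) ^ j • SOCP.resP A b z₀ ∧
        SOCP.resD A c (z j)
          = (1 - δ / Real.sqrt (2 * ((k : ℝ) + 1))) ^ j • SOCP.resD A c z₀ ∧
        SOCP.eucNorm (SOCP.resP A b (z j))
          = (1 - δ / Real.sqrt (2 * ((k : ℝ) + 1))) ^ j * SOCP.eucNorm (SOCP.resP A b z₀) ∧
        SOCP.eucNorm (SOCP.resD A c (z j))
          = (1 - δ / Real.sqrt (2 * ((k : ℝ) + 1))) ^ j * SOCP.eucNorm (SOCP.resD A c z₀) ∧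
        SOCP.mu (z j) = (1 - δ / Real.sqrt (2 * ((k : ℝ) + 1))) ^ j * SOCP.mu z₀ ∧
        -- the iteration complexity
        j ≤ ⌈C * Real.sqrt k * Real.log (1 / ε)⌉₊ ∧
        (⌈C * Real.sqrt k * Real.log (1 / ε)⌉₊ ≤ j → SOCP.Stop A b c ε z₀ (z j)) := by
  refine ⟨2 / δ, div_pos two_pos hδ.1, ?_⟩
  intro k hk hcond d p A hA b c z₀ hz₀ ε hε j z hrun
  have hν := SOCP.nuFactor_mem k hδ
  have hiter := fun i (hi : i ≤ j) => hrun.iterate hγ hδ hcond hz₀ hi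
  have hterm : ∀ i ≤ j, ⌈2 / δ * Real.sqrt k * Real.log (1 / ε)⌉₊ ≤ i →
      SOCP.Stop A b c ε z₀ (z i) := by
    intro i hi hle
    obtain ⟨-, hp, hd, hm⟩ := hiter i hi
    have hpow := SOCP.nuFactor_pow_le hδ hε hk (Nat.ceil_le.1 hle)
    have hpos := pow_nonneg hν.1.le i
    refine ⟨?_, ?_, ?_⟩
    · rw [hp, SOCP.eucNorm_smul _ _ hpos]
      exact mul_le_mul_of_nonneg_right hpow (SOCP.eucNorm_nonneg _)
    · rw [hd, SOCP.eucNorm_smul _ _ hpos]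
      exact mul_le_mul_of_nonneg_right hpow (SOCP.eucNorm_nonneg _)
    · rw [hm]
      exact mul_le_mul_of_nonneg_right hpow (SOCP.mu_pos hz₀).le
  obtain ⟨hn, hp, hd, hm⟩ := hiter j le_rfl
  have hpos := pow_nonneg hν.1.le j
  refine ⟨fun D hD => SOCP.existsUnique_isDirection hγ.1 hγ.2 hA hn hD, hn, hp, hd, ?_, ?_, hm,
    ?_, hterm j le_rfl⟩
  · rw [hp, SOCP.eucNorm_smul _ _ hpos]; rfl
  · rw [hd, SOCP.eucNorm_smul _ _ hpos]; rfl
  -- A longer run would have continued from the iterate whose index is the bound, where the stop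
  -- criteria already hold.
  · by_contra hlt
    push Not at hlt
    exact (hrun.2 _ hlt).1 (hterm _ hlt.le le_rfl)
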